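/- Let $(\Omega,\mathcal F,\mu)$ be a probability space, $\mathcal Y$ a finite set, $\Theta\subseteq\mathbb R^q$, and for $\theta\in\Theta$ let $f_\theta(y\mid x)$ be a model for $y\in\mathcal Y$ given $x\in\mathcal X$: $f_\theta(y\mid x)\ge 0$, measurable in $x$, and $\sum_{y\in\mathcal Y} f_\theta(y\mid x)\le 1$ (usually $=1$). For a joint density $g$ on $\mathcal X\times\mathcal Y$ write $g^x(x)=\sum_{y\in\mathcal Y}g(x,y)$ and $g_\theta(x,y)=f_\theta(y\mid x)\,g^x(x)$, and let $\mathrm{TVD}(g,g')=\int_{\mathcal X}\sum_{y\in\mathcal Y}|g(x,y)-g'(x,y)|\,dx$ (with $\int_{\mathcal X}dx$ replaced by $\sum_{x\in\mathcal X}$ if $\mathcal X$ is finite). Let $(x_i,y_i)_{i\ge1}$ be i.i.d. on $\Omega$ with law $P$ on $\mathcal X\times\mathcal Y$, in one of two settings. (D) $\mathcal X$ is finite, $p$ is the mass function of $P$, and $\hat g_n(x,y)=\frac1n\sum_{i=1}^n\mathbf 1\{(x_i,y_i)=(x,y)\}$ is the empirical mass function. (C) $\mathcal X\subseteq\mathbb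 R^d$ is measurable, the law of $x_i$ is absolutely continuous with respect to Lebesgue measure, $p$ is the density of $P$ with respect to (Lebesgue measure) $\otimes$ (counting measure), and $\hat g_n(x,y)=\frac1n\sum_{i=1}^n\mathbf 1\{y_i=y\}\,h_n^{-d}K\big(\frac{x_i-x}{h_n}\big)$ is the kernel density estimate, where $K:\mathbb R^d\to\mathbb R$ satisfies $\int_{\mathbb R^d} K=1$ and $h_n>0$, $h_n\to0$, $n h_n^d\to\infty$. In either setting put $L(\theta)=\mathrm{TVD}(p,p_\theta)$ and $L_n(\theta)=\mathrm{TVD}(\hat g_n,\hat g_{n,\theta})$, where $\hat g_{n,\theta}(x,y)=f_\theta(y\mid x)\,\hat g_n^x(x)$. Assume: $L$ has a unique minimizer $\theta^\ast$ over $\Theta$; for some $\varepsilon>0$ the set $B_\varepsilon=\{\theta\in\Theta:|L(\theta)-L(\theta^\ast)|<\varepsilon\}$ is compact; $L$ is continuous on $B_\varepsilon$; almost surely, $L_n$ is continuous on $B_\varepsilon$ for all $n$ large enough; and almost surely $\limsup_{n\to\infty}\sup_{\theta\in B_\varepsilon}\|\nabla_\theta L_n(\theta)\|<\infty$, where the gradient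 is taken relative to $\Theta$ and points at which it does not exist do not contribute. Assume also that, almost surely, for all $n$ large enough $\theta_n$ is the unique minimizer of $L_n$ over $\Theta$. Then: (1) in setting (D), $\theta_n\to\theta^\ast$ almost surely as $n\to\infty$; (2) in setting (C), with $n_y=\#\{i\le n: y_i=y\}$, $\theta_n\to\theta^\ast$ almost surely as $\min_{y\in\mathcal Y}n_y\to\infty$; that is, for almost every $\omega$ and every $\delta>0$ there is $N$ such that $\|\theta_n(\omega)-\theta^\ast\|<\delta$ for all $n$ with $\min_{y\in\mathcal Y}n_y(\omega)\ge N$. -/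

import Mathlib

open MeasureTheory ProbabilityTheory Filter Topology
open scoped ENNReal

noncomputable section

/-- `Z 0, Z 1, …` are independent and identically distributed random variables with law `P`. -/
structure IsIIDSample {Ω S : Type*} [MeasurableSpace Ω] [MeasurableSpace S]
    (Z : ℕ → Ω → S) (P : Measure S) (μ : Measure Ω) : Prop where
  indep : iIndepFun Z μ
  law : ∀ i, HasLaw (Z i) P μ

/-- `θ` is the unique minimizer of `L` over `Θ`. -/
def IsUniqueMinimizer {E : Type*} (Θ : Set E) (L : E → ℝ) (θ : E) : Prop :=
  θ ∈ Θ ∧ IsMinOn L Θ θ ∧ ∀ θ' ∈ Θ, IsMinOn L Θ θ' → θ' = θ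

/-! ### Joint densities on `𝒳 × 𝒴`, with `𝒴` finite -/

/-- The marginal in `x` of a joint density `g`. -/
def marginalX {𝒳 𝒴 : Type*} [Fintype 𝒴] (g : 𝒳 → 𝒴 → ℝ) (x : 𝒳) : ℝ := ∑ y, g x y

/-- The hybrid joint density `f(y | x) g(x)`: the model's conditional `f` combined with the
`x`-marginal of the joint density `g`. -/
def hybrid {𝒳 𝒴 : Type*} [Fintype 𝒴] (f : 𝒳 → 𝒴 → ℝ) (g : 𝒳 → 𝒴 → ℝ) (x : 𝒳) (y : 𝒴) : ℝ :=
  f x y * marginalX g x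

/-- `f x y = f(y | x)` is a conditional probability mass function on `𝒴` for each `x ∈ D`.
The usual case is total mass one; a smaller mass is permitted, so that the outcome space of the
model may be larger than `𝒴`. -/
structure IsCondMass {𝒳 𝒴 : Type*} [Fintype 𝒴] [MeasurableSpace 𝒳]
    (D : Set 𝒳) (f : 𝒳 → 𝒴 → ℝ) : Prop where
  measurable : ∀ y, Measurable fun x : D => f x y
  nonneg : ∀ x ∈ D, ∀ y, 0 ≤ f x y
  sum_le_one : ∀ x ∈ D, ∑ y, f x y ≤ 1

/-! ### Discrete covariates -/

/-- Total variation distance of two joint mass functions on a finite `𝒳 × 𝒴`. -/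
def tvdDiscrete {𝒳 𝒴 : Type*} [Fintype 𝒳] [Fintype 𝒴] (g g' : 𝒳 → 𝒴 → ℝ) : ℝ :=
  ∑ x, ∑ y, |g x y - g' x y|

/-- The joint mass function of `P`. -/
def jointMass {𝒳 𝒴 : Type*} [MeasurableSpace 𝒳] [MeasurableSpace 𝒴]
    (P : Measure (𝒳 × 𝒴)) (x : 𝒳) (y : 𝒴) : ℝ :=
  P.real {(x, y)}

/-- The joint empirical mass function of the first `n` observations. -/
def empiricalMass {Ω 𝒳 𝒴 : Type*} (Z : ℕ → Ω → 𝒳 × 𝒴) (n : ℕ) (ω : Ω) (x : 𝒳) (y : 𝒴) : ℝ :=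
  (n : ℝ)⁻¹ * ∑ i ∈ Finset.range n, Set.indicator {(x, y)} (fun _ => (1 : ℝ)) (Z i ω)

/-! ### Continuous covariates in `ℝᵈ` -/

/-- Total variation distance of two joint densities on `D × 𝒴`, with respect to
(Lebesgue measure) ⊗ (counting measure). -/
def tvdCont {d : ℕ} {𝒴 : Type*} [Fintype 𝒴] (D : Set (EuclideanSpace ℝ (Fin d)))
    (g g' : EuclideanSpace ℝ (Fin d) → 𝒴 → ℝ) : ℝ :=
  ∫ x in D, ∑ y, |g x y - g' x y|

/-- The joint density of `P` with respect to (Lebesgue measure) ⊗ (counting measure):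
`x ↦ jointDensity P x y` is the Lebesgue density of `A ↦ P (A × {y})`. -/
def jointDensity {d : ℕ} {𝒴 : Type*} [MeasurableSpace 𝒴]
    (P : Measure (EuclideanSpace ℝ (Fin d) × 𝒴)) (x : EuclideanSpace ℝ (Fin d)) (y : 𝒴) : ℝ :=
  (((P.restrict (Prod.snd ⁻¹' {y})).map Prod.fst).rnDeriv volume x).toReal

/-- The joint kernel density estimate with kernel `K` and bandwidth `h`, from the first `n`
observations. -/
def kernelEstimate {d : ℕ} {Ω 𝒴 : Type*} (K : EuclideanSpace ℝ (Fin d) → ℝ) (h : ℝ)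
    (Z : ℕ → Ω → EuclideanSpace ℝ (Fin d) × 𝒴) (n : ℕ) (ω : Ω)
    (x : EuclideanSpace ℝ (Fin d)) (y : 𝒴) : ℝ :=
  (n : ℝ)⁻¹ * ∑ i ∈ Finset.range n,
    Set.indicator {y} (fun _ => (1 : ℝ)) (Z i ω).2 *
      ((h ^ d)⁻¹ * K (h⁻¹ • ((Z i ω).1 - x)))

/-- The number of the first `n` observations whose outcome is `y`. -/
def outcomeCount {Ω 𝒳 𝒴 : Type*} (Z : ℕ → Ω → 𝒳 × 𝒴) (n : ℕ) (ω : Ω) (y : 𝒴) : ℕ :=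
  ∑ i ∈ Finset.range n, Set.indicator {y} (fun _ => 1) (Z i ω).2

/-! ### The regularity assumption -/

/-- The set of parameters whose objective is within `ε` of the value at `θstar`. -/
def levelNhd {E : Type*} (Θ : Set E) (L : E → ℝ) (θstar : E) (ε : ℝ) : Set E :=
  {θ ∈ Θ | |L θ - L θstar| < ε}

/-- Regularity of a population objective `L` and of its random estimates `Ln n ω`.
The gradient is taken relative to `Θ` (one-sided at the boundary); by Mathlib's convention points
where it does not exist contribute `0`, so kinks of the objective are not excluded. -/
structure RegularityAssumption {Ω : Type*} [MeasurableSpace Ω] (μ : Measure Ω) {q : ℕ}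
    (Θ : Set (EuclideanSpace ℝ (Fin q))) (L : EuclideanSpace ℝ (Fin q) → ℝ)
    (Ln : ℕ → Ω → EuclideanSpace ℝ (Fin q) → ℝ)
    (θstar : EuclideanSpace ℝ (Fin q)) (ε : ℝ) : Prop where
  unique_min : IsUniqueMinimizer Θ L θstar
  eps_pos : 0 < ε
  compact : IsCompact (levelNhd Θ L θstar ε)
  cont : ContinuousOn L (levelNhd Θ L θstar ε)
  cont_est : ∀ᵐ ω ∂μ, ∀ᶠ n in atTop, ContinuousOn (Ln n ω) (levelNhd Θ L θstar ε)
  grad_bdd : ∀ᵐ ω ∂μ,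
    limsup (fun n => ⨆ θ ∈ levelNhd Θ L θstar ε, ‖gradientWithin (Ln n ω) Θ θ‖ₑ) atTop < ⊤

end

/-! The map from a joint density g to its hybrid f_θ·g^x is linear and, because f_θ has mass at most
one, does not increase the L¹ distance. Hence |L_n(θ) − L(θ)| ≤ 2·TVD(ĝ_n, p) with a bound free of
θ, so L¹ consistency of ĝ_n already gives uniform convergence of the objectives over Θ. A minimizer
of L_n is then nearly optimal for L, enters the compact level set, and can accumulate only at the
unique minimizer (`IsUniqueMinimizer.tendsto_of_uniform`).

For finite 𝒳, consistency is the strong law for finitely many indicators. For the kernel estimate it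
is strong L¹ consistency for an arbitrary kernel of integral one and an arbitrary density. In mean,
K is replaced by a continuous compactly supported g at a cost of ‖K − g‖₁ uniformly in the
bandwidth; for g the bias vanishes by continuity of translations in L¹, and the fluctuation by a
variance bound of order 1/(n hᵈ) on a large ball together with tightness of P off it.

The passage to almost sure convergence is by concentration: moving one observation changes the L¹
error by at most 2‖K‖₁/n, so McDiarmid's inequality gives exponentially small tails and
Borel–Cantelli applies. Finally min n_y ≤ n, so a limit in n is also a limit in min n_y. -/

/-! ### Consistency of minimizers. -/

/-- Minimizers of uniformly converging objectives converge to a well-separated minimizer. -/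
theorem IsUniqueMinimizer.tendsto_of_uniform {E : Type*} [TopologicalSpace E] [T2Space E]
    {Θ : Set E} {L : E → ℝ} {θstar : E} {ε : ℝ} (hmin : IsUniqueMinimizer Θ L θstar)
    (hε : 0 < ε) (hcomp : IsCompact (levelNhd Θ L θstar ε))
    (hcont : ContinuousOn L (levelNhd Θ L θstar ε))
    {Ln : ℕ → E → ℝ} {D : ℕ → ℝ} (hD : Tendsto D atTop (𝓝 0))
    (hLn : ∀ n, ∀ θ ∈ Θ, |Ln n θ - L θ| ≤ D n) {θhat : ℕ → E}
    (hhat : ∀ᶠ n in atTop, θhat n ∈ Θ ∧ IsMinOn (Ln n) Θ (θhat n)) :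
    Tendsto θhat atTop (𝓝 θstar) := by
  -- The factor 2 is one `D n` for passing from `L` to `Ln n` at `θhat n` and one for passing back
  -- at `θstar`.
  have hgap : ∀ᶠ n in atTop, θhat n ∈ Θ ∧ |L (θhat n) - L θstar| ≤ 2 * D n := by
    filter_upwards [hhat] with n ⟨h1, h2⟩
    refine ⟨h1, ?_⟩
    have a := abs_le.1 (hLn n _ h1)
    have b := abs_le.1 (hLn n _ hmin.1)
    have c := isMinOn_iff.1 h2 _ hmin.1
    have e := isMinOn_iff.1 hmin.2.1 _ h1
    rw [abs_le]
    constructor <;> linarith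
  have hD2 : Tendsto (fun n => 2 * D n) atTop (𝓝 0) := by simpa using hD.const_mul 2
  have hmem : ∀ᶠ n in atTop, θhat n ∈ levelNhd Θ L θstar ε := by
    filter_upwards [hgap, hD2.eventually_lt_const hε] with n ⟨h1, h2⟩ h3
    exact ⟨h1, h2.trans_lt h3⟩
  have hL : Tendsto (fun n => L (θhat n)) atTop (𝓝 (L θstar)) := by
    rw [tendsto_iff_norm_sub_tendsto_zero]
    exact squeeze_zero' (Eventually.of_forall fun _ => norm_nonneg _)
      (hgap.mono fun n h => h.2) hD2
  -- By compactness it suffices that every cluster point of `θhat` in the level set minimizes `L`,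
  -- since the minimizer is unique.
  refine hcomp.tendsto_nhds_of_unique_mapClusterPt hmem fun θ hθ hcl => ?_
  have hcl' : MapClusterPt (L θ) atTop (fun n => L (θhat n)) := by
    have hw : Tendsto L (𝓝[levelNhd Θ L θstar ε] θ) (𝓝 (L θ)) := hcont θ hθ
    -- `L` is continuous only relative to the level set; the cluster point survives this restriction
    -- because `θhat` is eventually in that set.
    have hne : (𝓝[levelNhd Θ L θstar ε] θ ⊓ map θhat atTop).NeBot := by
      have : map θhat atTop ≤ 𝓟 (levelNhd Θ L θstar ε) := by simpa using hmem
      have h2 : (𝓝 θ ⊓ map θhat atTop).NeBot := hcl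
      rw [nhdsWithin, inf_assoc, inf_eq_right.2 this]
      exact h2
    have := hne.map L
    refine this.mono (map_inf_le.trans (inf_le_inf hw ?_))
    rw [map_map]; rfl
  have heq : L θ = L θstar := by
    have h1 : ClusterPt (L θ) (𝓝 (L θstar)) := ClusterPt.mono hcl' hL
    exact eq_of_nhds_neBot h1
  refine hmin.2.2 θ hθ.1 (isMinOn_iff.2 fun x hx => ?_)
  rw [heq]
  exact isMinOn_iff.1 hmin.2.1 x hx

/-! ### Stability of the objective under L¹ perturbation of the joint density. -/

/-- Hybrid densities built from a conditional mass function of total mass at most one move no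
further apart than the joint densities they are built from. -/
theorem abs_sum_abs_sub_hybrid_sub_le {𝒳 𝒴 : Type*} [Fintype 𝒴] {f g p : 𝒳 → 𝒴 → ℝ} {x : 𝒳}
    (h0 : ∀ y, 0 ≤ f x y) (h1 : ∑ y, f x y ≤ 1) :
    abs (∑ y, |g x y - hybrid f g x y| - ∑ y, |p x y - hybrid f p x y|)
      ≤ 2 * ∑ y, |g x y - p x y| := by
  have hm : |marginalX g x - marginalX p x| ≤ ∑ y, |g x y - p x y| := by
    rw [marginalX, marginalX, ← Finset.sum_sub_distrib]
    exact Finset.abs_sum_le_sum_abs _ _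
  calc abs (∑ y, |g x y - hybrid f g x y| - ∑ y, |p x y - hybrid f p x y|)
      ≤ ∑ y, abs (|g x y - hybrid f g x y| - |p x y - hybrid f p x y|) := by
        rw [← Finset.sum_sub_distrib]
        exact Finset.abs_sum_le_sum_abs _ _
    -- The factor 2 arises here: one copy of the distance from the densities, one from their
    -- marginals after summing the weights `f x y`.
    _ ≤ ∑ y, (|g x y - p x y| + f x y * |marginalX g x - marginalX p x|) := by
        refine Finset.sum_le_sum fun y _ => (abs_abs_sub_abs_le_abs_sub _ _).trans ?_
        have : g x y - hybrid f g x y - (p x y - hybrid f p x y)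
            = (g x y - p x y) - f x y * (marginalX g x - marginalX p x) := by
          simp only [hybrid]; ring
        rw [this]
        refine (abs_sub _ _).trans ?_
        rw [abs_mul, abs_of_nonneg (h0 y)]
    _ = ∑ y, |g x y - p x y| + (∑ y, f x y) * |marginalX g x - marginalX p x| := by
        rw [Finset.sum_add_distrib, Finset.sum_mul]
    _ ≤ ∑ y, |g x y - p x y| + 1 * ∑ y, |g x y - p x y| := by gcongr
    _ = 2 * ∑ y, |g x y - p x y| := by ring

theorem abs_tvdDiscrete_hybrid_sub_le {𝒳 𝒴 : Type*} [Fintype 𝒳] [Fintype 𝒴] [MeasurableSpace 𝒳]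
    {f g p : 𝒳 → 𝒴 → ℝ} (hf : IsCondMass Set.univ f) :
    |tvdDiscrete g (hybrid f g) - tvdDiscrete p (hybrid f p)| ≤ 2 * tvdDiscrete g p := by
  rw [tvdDiscrete, tvdDiscrete, tvdDiscrete, ← Finset.sum_sub_distrib, Finset.mul_sum]
  refine (Finset.abs_sum_le_sum_abs _ _).trans (Finset.sum_le_sum fun x _ => ?_)
  exact abs_sum_abs_sub_hybrid_sub_le (hf.nonneg x (Set.mem_univ x))
    (hf.sum_le_one x (Set.mem_univ x))

theorem IsCondMass.integrableOn_hybrid {d : ℕ} {𝒴 : Type*} [Fintype 𝒴]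
    {D : Set (EuclideanSpace ℝ (Fin d))} (hD : MeasurableSet D)
    {f g : EuclideanSpace ℝ (Fin d) → 𝒴 → ℝ}
    (hf : IsCondMass D f) (hg : ∀ y, IntegrableOn (fun x => g x y) D) (y : 𝒴) :
    IntegrableOn (fun x => hybrid f g x y) D := by
  refine Integrable.bdd_mul (c := 1) (integrable_finsetSum _ fun y _ => hg y) ?_ ?_
  · refine ((aemeasurable_restrict_iff_comap_subtype (μ := volume) (f := fun x => f x y) hD).2
      ?_).aestronglyMeasurable
    exact (hf.measurable y).aemeasurable
  · filter_upwards [ae_restrict_mem hD] with x hx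
    rw [Real.norm_eq_abs, abs_of_nonneg (hf.nonneg x hx y)]
    exact (Finset.single_le_sum (f := f x) (fun y _ => hf.nonneg x hx y)
      (Finset.mem_univ y)).trans (hf.sum_le_one x hx)

theorem abs_tvdCont_hybrid_sub_le {d : ℕ} {𝒴 : Type*} [Fintype 𝒴]
    {D : Set (EuclideanSpace ℝ (Fin d))} (hD : MeasurableSet D)
    {f g p : EuclideanSpace ℝ (Fin d) → 𝒴 → ℝ} (hf : IsCondMass D f)
    (hg : ∀ y, IntegrableOn (fun x => g x y) D) (hp : ∀ y, IntegrableOn (fun x => p x y) D) :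
    |tvdCont D g (hybrid f g) - tvdCont D p (hybrid f p)| ≤ 2 * tvdCont D g p := by
  have hint : ∀ {g : EuclideanSpace ℝ (Fin d) → 𝒴 → ℝ},
      (∀ y, IntegrableOn (fun x => g x y) D) →
        IntegrableOn (fun x => ∑ y, |g x y - hybrid f g x y|) D := fun hg =>
    integrable_finsetSum _ fun y _ => ((hg y).sub (hf.integrableOn_hybrid hD hg y)).abs
  rw [tvdCont, tvdCont, tvdCont, ← integral_sub (hint hg) (hint hp), ← integral_const_mul]
  refine abs_integral_le_integral_abs.trans (integral_mono_ae ((hint hg).sub (hint hp)).abs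
    ((integrable_finsetSum _ fun y _ => ((hg y).sub (hp y)).abs).const_mul 2) ?_)
  filter_upwards [ae_restrict_mem hD] with x hx
  exact abs_sum_abs_sub_hybrid_sub_le (hf.nonneg x hx) (hf.sum_le_one x hx)

/-! ### Consistency of the empirical mass function. -/

/-- The strong law of large numbers for the empirical mass function. -/
theorem IsIIDSample.tendsto_empiricalMass {Ω : Type*} [MeasurableSpace Ω] {μ : Measure Ω}
    [IsProbabilityMeasure μ] {𝒳 𝒴 : Type*} [MeasurableSpace 𝒳] [MeasurableSpace 𝒴]
    [MeasurableSingletonClass 𝒳] [MeasurableSingletonClass 𝒴]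
    {P : Measure (𝒳 × 𝒴)} {Z : ℕ → Ω → 𝒳 × 𝒴} (hZ : IsIIDSample Z P μ) (x : 𝒳) (y : 𝒴) :
    ∀ᵐ ω ∂μ, Tendsto (fun n => empiricalMass Z n ω x y) atTop (𝓝 (jointMass P x y)) := by
  have hφ : Measurable (Set.indicator {(x, y)} (fun _ => (1 : ℝ)) : 𝒳 × 𝒴 → ℝ) :=
    measurable_const.indicator (measurableSet_singleton _)
  have hm : ∀ i, AEMeasurable (Z i) μ := fun i => (hZ.law i).aemeasurable
  have hb : Integrable (fun ω => Set.indicator {(x, y)} (fun _ => (1 : ℝ)) (Z 0 ω)) μ :=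
    Integrable.of_mem_Icc 0 1 (hφ.comp_aemeasurable (hm 0)) (Eventually.of_forall fun ω =>
      ⟨Set.indicator_nonneg (fun _ _ => zero_le_one) _,
        Set.indicator_le_self' (fun _ _ => zero_le_one) _⟩)
  have key := strong_law_ae_real
    (fun i ω => Set.indicator {(x, y)} (fun _ => (1 : ℝ)) (Z i ω)) hb
    (fun i j hij => (hZ.indep.indepFun hij).comp hφ hφ)
    (fun i => (IdentDistrib.mk (hm i) (hm 0)
      ((hZ.law i).map_eq.trans (hZ.law 0).map_eq.symm)).comp hφ)
  have hval : ∫ ω, Set.indicator {(x, y)} (fun _ => (1 : ℝ)) (Z 0 ω) ∂μ = jointMass P x y := by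
    rw [← integral_map (hm 0) hφ.aestronglyMeasurable, (hZ.law 0).map_eq,
      integral_indicator_const _ (measurableSet_singleton _)]
    simp [jointMass]
  filter_upwards [key] with ω hω
  rw [hval] at hω
  simpa [empiricalMass, div_eq_inv_mul] using hω

/-! ### Concentration under bounded differences. -/

/-- **McDiarmid's inequality**: a function of `n` independent variables that changes by at most
`c` when one variable is changed is sub-Gaussian around its mean. -/
theorem hasSubgaussianMGF_of_bounded_differences {S : Type*} [MeasurableSpace S] (P : Measure S)
    [IsProbabilityMeasure P] (c : NNReal) : ∀ (n : ℕ) (F : (Fin n → S) → ℝ), Measurable F →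
      ∀ C : ℝ, (∀ z, |F z| ≤ C) → (∀ z i s, |F (Function.update z i s) - F z| ≤ c) →
      HasSubgaussianMGF (fun z => F z - ∫ z, F z ∂Measure.pi fun _ => P) (n * c ^ 2)
        (Measure.pi fun _ => P) := by
  intro n
  induction n with
  | zero =>
    intro F hF C hC _
    have : ∀ z, F z - ∫ z, F z ∂(Measure.pi fun _ : Fin 0 => P) = 0 := by
      intro z
      have : F = fun _ => F z := by ext w; rw [Subsingleton.elim w z]
      rw [this]; simp
    simp only [this]
    simp
  | succ n ih =>
    intro F hF C hC hdiff
    set Q := Measure.pi fun _ : Fin n => P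
    let cons : S × (Fin n → S) → (Fin (n + 1) → S) :=
      (MeasurableEquiv.piFinSuccAbove (fun _ => S) 0).symm
    have hmp : MeasurePreserving cons (P.prod Q) (Measure.pi fun _ => P) :=
      (measurePreserving_piFinSuccAbove (fun _ : Fin (n + 1) => P) 0).symm
    have hemb : MeasurableEmbedding cons := MeasurableEquiv.measurableEmbedding _
    have hcons : ∀ s z, cons (s, z) = Fin.cons s z := by
      intro s z
      simp [cons, Fin.insertNthEquiv]
    have hint : ∀ g : (Fin (n + 1) → S) → ℝ, Integrable g (Measure.pi fun _ => P) →
        ∫ w, g w ∂(Measure.pi fun _ => P) = ∫ z, ∫ s, g (cons (s, z)) ∂P ∂Q := by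
      intro g hg
      rw [← hmp.integral_comp hemb]
      exact integral_prod_symm _ ((hmp.integrable_comp_emb hemb).2 hg)
    -- Averaging out the first coordinate keeps the bound `C`, the differences `c` and the mean, so
    -- the induction hypothesis applies to `G`; what remains is the fluctuation in that coordinate.
    set G : (Fin n → S) → ℝ := fun z => ∫ s, F (cons (s, z)) ∂P
    have hFc : Measurable fun p : S × (Fin n → S) => F (cons p) := hF.comp hmp.measurable
    have hFs : ∀ z, Measurable fun s => F (cons (s, z)) := fun z => hFc.comp (by fun_prop)
    have hFi : ∀ z, Integrable (fun s => F (cons (s, z))) P := fun z =>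
      Integrable.of_bound (hFs z).aestronglyMeasurable C (Eventually.of_forall fun s => hC _)
    have hGm : Measurable G :=
      (hFc.comp measurable_swap).stronglyMeasurable.integral_prod_right'.measurable
    have hGC : ∀ z, |G z| ≤ C := fun z => by
      simpa using norm_integral_le_of_norm_le_const (μ := P) (f := fun s => F (cons (s, z)))
        (Eventually.of_forall fun s => hC (cons (s, z)))
    have hGd : ∀ z i s, |G (Function.update z i s) - G z| ≤ c := fun z i s => by
      simp only [G]
      rw [← integral_sub (hFi _) (hFi _)]
      have : ∀ t, ‖F (cons (t, Function.update z i s)) - F (cons (t, z))‖ ≤ c := fun t => by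
        rw [hcons, hcons, Fin.cons_update]
        exact hdiff _ _ _
      simpa using norm_integral_le_of_norm_le_const (μ := P) (Eventually.of_forall this)
    have hIH := ih G hGm C hGC hGd
    have hbd : ∀ w : Fin (n + 1) → S, F w ∈ Set.Icc (-C) C := fun w => abs_le.1 (hC w)
    have hFpi : Integrable F (Measure.pi fun _ => P) :=
      Integrable.of_bound hF.aestronglyMeasurable C (Eventually.of_forall hC)
    set m := ∫ w, F w ∂(Measure.pi fun _ => P) with hm
    have hmG : m = ∫ z, G z ∂Q := hint F hFpi
    have hexp : ∀ t, Integrable (fun w => Real.exp (t * (F w - m))) (Measure.pi fun _ => P) :=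
      fun t => integrable_exp_mul_of_mem_Icc (a := -C - m) (b := C - m)
        (hF.sub_const m).aemeasurable
        (Eventually.of_forall fun w => ⟨by linarith [(hbd w).1], by linarith [(hbd w).2]⟩)
    refine ⟨hexp, fun t => ?_⟩
    have hinner : ∀ z, ∫ s, Real.exp (t * (F (cons (s, z)) - m)) ∂P
        ≤ Real.exp (c ^ 2 * t ^ 2 / 2) * Real.exp (t * (G z - m)) := by
      intro z
      obtain ⟨s₀⟩ : Nonempty S := nonempty_of_isProbabilityMeasure P
      -- For fixed `z` all values lie within `c` of the one at `s₀`. Hoeffding's lemma on this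
      -- interval of length `2 * c` gives variance proxy `c ^ 2`, four times the sharp constant but
      -- sufficient.
      have hw : ∀ s, F (cons (s, z)) ∈ Set.Icc (F (cons (s₀, z)) - c) (F (cons (s₀, z)) + c) := by
        intro s
        have := abs_le.1 (hdiff (cons (s₀, z)) 0 s)
        rw [hcons, Fin.update_cons_zero, ← hcons, ← hcons] at this
        constructor <;> linarith
      have h1 := (hasSubgaussianMGF_of_mem_Icc (μ := P) (hFs z).aemeasurable
        (Eventually.of_forall hw)).mgf_le t
      have h2 : ((‖F (cons (s₀, z)) + c - (F (cons (s₀, z)) - c)‖₊ / 2) ^ 2 : NNReal) = c ^ 2 := by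
        have : F (cons (s₀, z)) + c - (F (cons (s₀, z)) - c) = 2 * c := by ring
        rw [this]
        ext
        simp
      rw [h2] at h1
      have h3 : ∀ s, Real.exp (t * (F (cons (s, z)) - m))
          = Real.exp (t * (F (cons (s, z)) - G z)) * Real.exp (t * (G z - m)) := fun s => by
        rw [← Real.exp_add]; ring_nf
      simp_rw [h3]
      rw [integral_mul_const]
      gcongr
      simpa [mgf] using h1
    calc mgf (fun w => F w - m) (Measure.pi fun _ => P) t
        = ∫ z, ∫ s, Real.exp (t * (F (cons (s, z)) - m)) ∂P ∂Q := hint _ (hexp t)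
      _ ≤ ∫ z, Real.exp (c ^ 2 * t ^ 2 / 2) * Real.exp (t * (G z - m)) ∂Q := by
        refine integral_mono_of_nonneg
          (Eventually.of_forall fun z => integral_nonneg fun s => (Real.exp_pos _).le) ?_
          (Eventually.of_forall hinner)
        rw [hmG]
        exact (hIH.integrable_exp_mul t).const_mul _
      _ ≤ Real.exp (c ^ 2 * t ^ 2 / 2) * Real.exp (n * c ^ 2 * t ^ 2 / 2) := by
        rw [integral_const_mul, hmG]
        gcongr
        simpa [mgf] using hIH.mgf_le t
      _ = Real.exp ((↑((n + 1 : ℕ) * c ^ 2 : NNReal)) * t ^ 2 / 2) := by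
        rw [← Real.exp_add]
        push_cast
        ring_nf

/-! ### Moments of sample means. -/

/-- The average of `w` over the `n` observations `z`. -/
noncomputable def sampleMean {S : Type*} (n : ℕ) (w : S → ℝ) (z : Fin n → S) : ℝ := (n : ℝ)⁻¹ * ∑ i, w (z i)

/-- The contribution of one observation `z` to the joint kernel density estimate at `(x, y)`. -/
noncomputable def kernelWeight {d : ℕ} {𝒴 : Type*} (K : EuclideanSpace ℝ (Fin d) → ℝ) (h : ℝ) (y : 𝒴)
    (x : EuclideanSpace ℝ (Fin d)) (z : EuclideanSpace ℝ (Fin d) × 𝒴) : ℝ :=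
  Set.indicator {y} (fun _ => (1 : ℝ)) z.2 * ((h ^ d)⁻¹ * K (h⁻¹ • (z.1 - x)))

theorem kernelEstimate_eq_sampleMean {d : ℕ} {Ω 𝒴 : Type*} (K : EuclideanSpace ℝ (Fin d) → ℝ)
    (h : ℝ) (Z : ℕ → Ω → EuclideanSpace ℝ (Fin d) × 𝒴) (n : ℕ) (ω : Ω)
    (x : EuclideanSpace ℝ (Fin d)) (y : 𝒴) :
    kernelEstimate K h Z n ω x y = sampleMean n (kernelWeight K h y x) fun i => Z i ω := by
  rw [kernelEstimate, sampleMean, Finset.sum_range]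
  rfl

theorem enorm_sampleMean_le {S : Type*} {n : ℕ} (w : S → ℝ) (z : Fin n → S) :
    ‖sampleMean n w z‖ₑ ≤ (n : ℝ≥0∞)⁻¹ * ∑ i, ‖w (z i)‖ₑ := by
  rw [sampleMean, enorm_mul]
  gcongr
  -- At `n = 0` the real inverse is `0` while the one in `ℝ≥0∞` is `∞`, so only the inequality
  -- holds.
  · rcases Nat.eq_zero_or_pos n with rfl | hn
    · simp
    · rw [enorm_inv (by positivity)]
      simp
  · exact enorm_sum_le _ _

section SampleMean

variable {S : Type*} [MeasurableSpace S] {P : Measure S} [IsProbabilityMeasure P]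

theorem measurable_sampleMean {n : ℕ} {w : S → ℝ} (hw : Measurable w) :
    Measurable (sampleMean n w) :=
  (Finset.measurable_sum _ fun i _ => hw.comp (measurable_pi_apply i)).const_mul _

theorem lintegral_enorm_sampleMean_le {n : ℕ} {w : S → ℝ} (hw : Measurable w) :
    ∫⁻ z, ‖sampleMean n w z‖ₑ ∂(Measure.pi fun _ => P) ≤ ∫⁻ s, ‖w s‖ₑ ∂P := by
  calc ∫⁻ z, ‖sampleMean n w z‖ₑ ∂(Measure.pi fun _ => P)
      ≤ ∫⁻ z, (n : ℝ≥0∞)⁻¹ * ∑ i, ‖w (z i)‖ₑ ∂(Measure.pi fun _ => P) :=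
        lintegral_mono fun z => enorm_sampleMean_le w z
    _ = (n : ℝ≥0∞)⁻¹ * ∑ _i : Fin n, ∫⁻ s, ‖w s‖ₑ ∂P := by
        rw [lintegral_const_mul _ (by fun_prop), lintegral_finsetSum _ (by fun_prop)]
        congr 1
        refine Finset.sum_congr rfl fun i _ => ?_
        exact (measurePreserving_eval (fun _ : Fin n => P) i).lintegral_comp
          (f := fun s => ‖w s‖ₑ) (by fun_prop)
    _ ≤ ∫⁻ s, ‖w s‖ₑ ∂P := by
        rw [Finset.sum_const, Finset.card_univ, Fintype.card_fin, nsmul_eq_mul, ← mul_assoc]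
        calc _ ≤ 1 * ∫⁻ s, ‖w s‖ₑ ∂P := by gcongr; exact ENNReal.inv_mul_le_one _
          _ = _ := one_mul _

/-- This bound does not improve with `n`; it serves far from the origin, where smallness comes from
the tail of `P`. -/
theorem lintegral_enorm_sampleMean_sub_integral_le {n : ℕ} {w : S → ℝ} (hw : Measurable w) :
    ∫⁻ z, ‖sampleMean n w z - ∫ s, w s ∂P‖ₑ ∂(Measure.pi fun _ => P) ≤ 2 * ∫⁻ s, ‖w s‖ₑ ∂P := by
  calc ∫⁻ z, ‖sampleMean n w z - ∫ s, w s ∂P‖ₑ ∂(Measure.pi fun _ => P)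
      ≤ ∫⁻ z, (‖sampleMean n w z‖ₑ + ∫⁻ s, ‖w s‖ₑ ∂P) ∂(Measure.pi fun _ => P) := by
        refine lintegral_mono fun z => enorm_sub_le.trans ?_
        gcongr
        exact enorm_integral_le_lintegral_enorm _
    _ ≤ 2 * ∫⁻ s, ‖w s‖ₑ ∂P := by
        rw [lintegral_add_right _ measurable_const, lintegral_const, measure_univ, mul_one, two_mul]
        gcongr
        exact lintegral_enorm_sampleMean_le hw

/-- The mean squared error of the average of `n` independent copies of `w`. -/
theorem lintegral_enorm_sampleMean_sub_integral_sq_le {n : ℕ} (hn : n ≠ 0) {w : S → ℝ}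
    (hw : MemLp w 2 P) :
    ∫⁻ z, ‖sampleMean n w z - ∫ s, w s ∂P‖ₑ ^ 2 ∂(Measure.pi fun _ => P)
      ≤ (n : ℝ≥0∞)⁻¹ * ∫⁻ s, ‖w s‖ₑ ^ 2 ∂P := by
  have hn' : (n : ℝ) ≠ 0 := by exact_mod_cast hn
  have hcomp : ∀ i : Fin n, MemLp (fun z : Fin n → S => w (z i)) 2 (Measure.pi fun _ => P) :=
    fun i => hw.comp_measurePreserving (measurePreserving_eval (fun _ => P) i)
  have hsum : MemLp (∑ i : Fin n, fun z : Fin n → S => w (z i)) 2 (Measure.pi fun _ => P) :=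
    memLp_finsetSum' _ fun i _ => hcomp i
  have heq : sampleMean n w = fun z => (n : ℝ)⁻¹ * (∑ i : Fin n, fun z : Fin n → S => w (z i)) z := by
    ext z; simp [sampleMean]
  have hmem : MemLp (sampleMean n w) 2 (Measure.pi fun _ => P) := by
    rw [heq]; exact hsum.const_mul _
  have hmean : ∫ z, sampleMean n w z ∂(Measure.pi fun _ => P) = ∫ s, w s ∂P := by
    simp only [sampleMean]
    rw [integral_const_mul, integral_finsetSum _ fun i _ => (hcomp i).integrable one_le_two]
    have : ∀ i : Fin n, ∫ z : Fin n → S, w (z i) ∂(Measure.pi fun _ => P) = ∫ s, w s ∂P := by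
      intro i
      exact integral_comp_eval (μ := fun _ => P) hw.1
    simp only [this, Finset.sum_const, Finset.card_univ, Fintype.card_fin, nsmul_eq_mul]
    field_simp
  have hvar : Var[sampleMean n w; Measure.pi fun _ => P] = (n : ℝ)⁻¹ * Var[w; P] := by
    rw [heq, variance_const_mul, variance_sum_pi (μ := fun _ : Fin n => P) fun _ => hw]
    simp only [Finset.sum_const, Finset.card_univ, Fintype.card_fin, nsmul_eq_mul]
    field_simp
  calc ∫⁻ z, ‖sampleMean n w z - ∫ s, w s ∂P‖ₑ ^ 2 ∂(Measure.pi fun _ => P)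
      = ENNReal.ofReal (Var[sampleMean n w; Measure.pi fun _ => P]) := by
        rw [ofReal_variance hmem, evariance, hmean]
    _ ≤ ENNReal.ofReal ((n : ℝ)⁻¹ * ∫ s, w s ^ 2 ∂P) := by
        rw [hvar]
        gcongr
        exact variance_le_expectation_sq hw.1
    _ = (n : ℝ≥0∞)⁻¹ * ∫⁻ s, ‖w s‖ₑ ^ 2 ∂P := by
        rw [ENNReal.ofReal_mul (by positivity), ENNReal.ofReal_inv_of_pos (by positivity),
          ENNReal.ofReal_natCast, ofReal_integral_eq_lintegral_ofReal hw.integrable_sq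
            (Eventually.of_forall fun s => sq_nonneg _)]
        congr 2
        ext s
        rw [← sq_abs, ENNReal.ofReal_pow (abs_nonneg _), ← Real.enorm_eq_ofReal_abs]

end SampleMean

/-- Turns a second-moment bound into a first-moment bound on a set of finite volume, without square
roots. -/
theorem ENNReal.le_add_inv_mul_sq {δ : ℝ≥0∞} (h0 : δ ≠ 0) (htop : δ ≠ ∞) (a : ℝ≥0∞) :
    a ≤ δ + δ⁻¹ * a ^ 2 := by
  rcases le_total a δ with h | h
  · exact h.trans le_self_add
  · refine le_trans ?_ le_add_self
    calc a = δ⁻¹ * (a * δ) := by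
          rw [mul_comm a, ← mul_assoc, ENNReal.inv_mul_cancel h0 htop, one_mul]
      _ ≤ δ⁻¹ * a ^ 2 := by rw [sq]; gcongr

/-! ### Rescaled kernels and translations in L¹. -/

section Kernel

variable {d : ℕ}

local notation "𝔼" => EuclideanSpace ℝ (Fin d)

theorem lintegral_comp_inv_smul (φ : 𝔼 → ℝ≥0∞) {h : ℝ} (hh : 0 < h) :
    ∫⁻ x, φ (h⁻¹ • x) = ENNReal.ofReal (h ^ d) * ∫⁻ u, φ u := by
  have h1 : ∫⁻ u, φ u ∂(Measure.map (h⁻¹ • ·) (volume : Measure 𝔼)) = ∫⁻ x, φ (h⁻¹ • x) :=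
    lintegral_map_equiv (μ := (volume : Measure 𝔼)) φ
      (Homeomorph.smul (isUnit_iff_ne_zero.2 (inv_ne_zero hh.ne')).unit).toMeasurableEquiv
  rw [← h1, Measure.map_addHaar_smul (volume : Measure 𝔼) (inv_ne_zero hh.ne'),
    lintegral_smul_measure, finrank_euclideanSpace_fin, inv_pow, inv_inv,
    abs_of_pos (by positivity), smul_eq_mul]

theorem lintegral_comp_inv_smul_sub (φ : 𝔼 → ℝ≥0∞) {h : ℝ} (hh : 0 < h) (a : 𝔼) :
    ∫⁻ x, φ (h⁻¹ • (a - x)) = ENNReal.ofReal (h ^ d) * ∫⁻ u, φ u := by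
  rw [lintegral_sub_left_eq_self (fun x => φ (h⁻¹ • x)) a, lintegral_comp_inv_smul φ hh]

theorem integral_comp_inv_smul_sub (φ : 𝔼 → ℝ) {h : ℝ} (hh : 0 < h) (x : 𝔼) :
    ∫ a, φ (h⁻¹ • (a - x)) = h ^ d * ∫ u, φ u := by
  rw [integral_sub_right_eq_self (fun x => φ (h⁻¹ • x)) x, Measure.integral_comp_smul,
    finrank_euclideanSpace_fin, inv_pow, inv_inv, abs_of_pos (by positivity), smul_eq_mul]

/-- Translation acts continuously on `Lp` for finite exponent; the integral is the distance between
a translate and the original. -/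
theorem tendsto_lintegral_enorm_comp_add_sub {p : 𝔼 → ℝ} (hp : Integrable p) :
    Tendsto (fun v : 𝔼 => ∫⁻ x, ‖p (v + x) - p x‖ₑ) (𝓝 0) (𝓝 0) := by
  have : Fact ((1 : ℝ≥0∞) ≠ ∞) := ⟨ENNReal.one_ne_top⟩
  have hp1 : MemLp p 1 := memLp_one_iff_integrable.2 hp
  have hcont : Continuous fun v : 𝔼 => edist (DomAddAct.mk v +ᵥ hp1.toLp p) (hp1.toLp p) := by
    exact (continuous_vadd.comp (DomAddAct.continuous_mk.prodMk continuous_const)).edist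
      continuous_const
  have h0 : edist (DomAddAct.mk (0 : 𝔼) +ᵥ hp1.toLp p) (hp1.toLp p) = 0 := by
    simp
  have key := hcont.tendsto 0
  rw [h0] at key
  refine key.congr fun v => ?_
  rw [DomAddAct.mk_vadd_toLp, Lp.edist_toLp_toLp, eLpNorm_one_eq_lintegral_enorm]
  rfl

variable {𝒴 : Type*}

theorem measurable_kernelWeight [MeasurableSpace 𝒴] [MeasurableSingletonClass 𝒴] {K : 𝔼 → ℝ} (hK : Measurable K) (h : ℝ) (y : 𝒴) :
    Measurable fun q : 𝔼 × (𝔼 × 𝒴) => kernelWeight K h y q.1 q.2 := by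
  have h1 : Measurable (Set.indicator {y} (fun _ => (1 : ℝ))) :=
    measurable_const.indicator (measurableSet_singleton y)
  exact (h1.comp (by fun_prop)).mul ((hK.comp (by fun_prop)).const_mul _)

theorem enorm_kernelWeight_le (K : 𝔼 → ℝ) {h : ℝ} (hh : 0 < h) (y : 𝒴) (x : 𝔼) (z : 𝔼 × 𝒴) :
    ‖kernelWeight K h y x z‖ₑ ≤ (ENNReal.ofReal (h ^ d))⁻¹ * ‖K (h⁻¹ • (z.1 - x))‖ₑ := by
  rw [kernelWeight, enorm_mul, enorm_mul]
  have h1 : ‖Set.indicator {y} (fun _ => (1 : ℝ)) z.2‖ₑ ≤ 1 := by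
    by_cases hz : z.2 ∈ ({y} : Set 𝒴) <;> simp [hz]
  have h2 : ‖(h ^ d)⁻¹‖ₑ = (ENNReal.ofReal (h ^ d))⁻¹ := by
    rw [enorm_inv (by positivity), Real.enorm_of_nonneg (by positivity)]
  rw [h2]
  calc _ ≤ 1 * ((ENNReal.ofReal (h ^ d))⁻¹ * ‖K (h⁻¹ • (z.1 - x))‖ₑ) := by gcongr
    _ = _ := one_mul _

theorem lintegral_enorm_kernelWeight_le (K : 𝔼 → ℝ) {h : ℝ} (hh : 0 < h) (y : 𝒴) (z : 𝔼 × 𝒴) :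
    ∫⁻ x, ‖kernelWeight K h y x z‖ₑ ≤ ∫⁻ u, ‖K u‖ₑ := by
  refine (lintegral_mono fun x => enorm_kernelWeight_le K hh y x z).trans ?_
  have hpos : ENNReal.ofReal (h ^ d) ≠ 0 := by simp [hh]
  rw [lintegral_const_mul' _ _ (by simpa using hpos),
    lintegral_comp_inv_smul_sub (fun u => ‖K u‖ₑ) hh, ← mul_assoc,
    ENNReal.inv_mul_cancel hpos ENNReal.ofReal_ne_top, one_mul]

/-- Squaring produces the factor h⁻ᵈ twice and the change of variables cancels it once; divided by
n, this is why n hᵈ must tend to infinity. -/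
theorem lintegral_enorm_kernelWeight_sq_le (K : 𝔼 → ℝ) {h : ℝ} (hh : 0 < h) (y : 𝒴) (z : 𝔼 × 𝒴) :
    ∫⁻ x, ‖kernelWeight K h y x z‖ₑ ^ 2 ≤ (ENNReal.ofReal (h ^ d))⁻¹ * ∫⁻ u, ‖K u‖ₑ ^ 2 := by
  refine (lintegral_mono fun x => pow_le_pow_left' (enorm_kernelWeight_le K hh y x z) 2).trans ?_
  have hpos : ENNReal.ofReal (h ^ d) ≠ 0 := by simp [hh]
  simp_rw [mul_pow]
  rw [lintegral_const_mul' _ _ (by simpa using hpos),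
    lintegral_comp_inv_smul_sub (fun u => ‖K u‖ₑ ^ 2) hh, ← mul_assoc, sq, mul_assoc _ _ (ENNReal.ofReal _),
    ENNReal.inv_mul_cancel hpos ENNReal.ofReal_ne_top, mul_one]

end Kernel

/-! ### Bias and fluctuation of the kernel estimate for a continuous compactly supported kernel. -/

section KernelMean

variable {d : ℕ}

local notation "𝔼" => EuclideanSpace ℝ (Fin d)

/-- Smoothing an integrable function by a rescaled kernel converges in `L¹`. -/
theorem tendsto_lintegral_enorm_smoothing_sub {p : 𝔼 → ℝ} (hpm : Measurable p)
    (hp : Integrable p) {g : 𝔼 → ℝ} (hg : Continuous g) (hgs : HasCompactSupport g)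
    {h : ℕ → ℝ} (hpos : ∀ n, 0 < h n) (hh : Tendsto h atTop (𝓝 0)) :
    Tendsto (fun n => ∫⁻ x, ‖(∫ a, ((h n ^ d)⁻¹ * g ((h n)⁻¹ • (a - x))) * p a)
      - (∫ u, g u) * p x‖ₑ) atTop (𝓝 0) := by
  have hgi : Integrable g := hg.integrable_of_hasCompactSupport hgs
  obtain ⟨M, hM⟩ := hgs.exists_bound_of_continuous hg
  obtain ⟨ρ, hρ0, hρ⟩ : ∃ ρ : ℝ, 0 < ρ ∧ ∀ u, g u ≠ 0 → ‖u‖ ≤ ρ := by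
    obtain ⟨ρ, h1, h2⟩ := hgs.isCompact.isBounded.exists_pos_norm_le
    -- The support radius `ρ` confines the rescaled kernel to `‖v‖ ≤ h n * ρ`.
    exact ⟨ρ, h1, fun u hu => h2 u (subset_tsupport g hu)⟩
  set T : 𝔼 → ℝ≥0∞ := fun v => ∫⁻ x, ‖p (v + x) - p x‖ₑ with hT
  have hbound : ∀ n, ∫⁻ x, ‖(∫ a, ((h n ^ d)⁻¹ * g ((h n)⁻¹ • (a - x))) * p a)
      - (∫ u, g u) * p x‖ₑ
      ≤ ∫⁻ v, (ENNReal.ofReal (h n ^ d))⁻¹ * ‖g ((h n)⁻¹ • v)‖ₑ * T v := by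
    intro n
    have hn := hpos n
    have hpt : ∀ x, ‖(∫ a, ((h n ^ d)⁻¹ * g ((h n)⁻¹ • (a - x))) * p a) - (∫ u, g u) * p x‖ₑ
        ≤ ∫⁻ v, (ENNReal.ofReal (h n ^ d))⁻¹ * ‖g ((h n)⁻¹ • v)‖ₑ * ‖p (v + x) - p x‖ₑ := by
      intro x
      have hi1 : Integrable fun a => ((h n ^ d)⁻¹ * g ((h n)⁻¹ • (a - x))) * p a := by
        refine hp.bdd_mul (c := ‖(h n ^ d)⁻¹‖ * M) (by fun_prop) (Eventually.of_forall fun a => ?_)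
        rw [norm_mul]
        gcongr
        exact hM _
      have hi2 : Integrable fun a => ((h n ^ d)⁻¹ * g ((h n)⁻¹ • (a - x))) * p x := by
        refine (Integrable.const_mul ?_ _).mul_const _
        exact (hgi.comp_smul (inv_ne_zero hn.ne')).comp_sub_right x
      have h2 : ∫ a, ((h n ^ d)⁻¹ * g ((h n)⁻¹ • (a - x))) * p x = (∫ u, g u) * p x := by
        rw [integral_mul_const, integral_const_mul, integral_comp_inv_smul_sub g hn, ← mul_assoc,
          inv_mul_cancel₀ (by positivity), one_mul]
      rw [← h2, ← integral_sub hi1 hi2]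
      refine (enorm_integral_le_lintegral_enorm _).trans (le_of_eq ?_)
      rw [← lintegral_add_right_eq_self _ x]
      refine lintegral_congr fun v => ?_
      rw [← mul_sub, enorm_mul, enorm_mul, add_sub_cancel_right, enorm_inv (by positivity),
        Real.enorm_of_nonneg (by positivity : (0 : ℝ) ≤ h n ^ d)]
    refine (lintegral_mono hpt).trans (le_of_eq ?_)
    -- Tonelli bounds the bias by the average of the L¹ translation error `T v` against the rescaled
    -- kernel.
    rw [lintegral_lintegral_swap (by fun_prop)]
    refine lintegral_congr fun v => ?_
    rw [lintegral_const_mul _ (by fun_prop)]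
  rw [ENNReal.tendsto_nhds_zero]
  intro η hη
  have hgfin : ∫⁻ u, ‖g u‖ₑ ≠ ∞ := hgi.2.ne
  obtain ⟨η', hη', hη'2⟩ : ∃ η' : ℝ≥0∞, 0 < η' ∧ η' * ∫⁻ u, ‖g u‖ₑ ≤ η := by
    obtain ⟨δ, hδ, hδ2⟩ := ENNReal.exists_nnreal_pos_mul_lt hgfin hη.ne'
    exact ⟨δ, by exact_mod_cast hδ, hδ2.le⟩
  have hTt := ENNReal.tendsto_nhds_zero.1 (tendsto_lintegral_enorm_comp_add_sub hp) η' hη'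
  obtain ⟨r, hr, hrT⟩ := Metric.eventually_nhds_iff.1 hTt
  filter_upwards [hh.eventually_lt_const (div_pos hr hρ0)] with n hn
  have hn0 := hpos n
  refine (hbound n).trans ?_
  -- Where the kernel is nonzero, `‖v‖ ≤ h n * ρ < r`, hence `T v ≤ η'`.
  calc ∫⁻ v, (ENNReal.ofReal (h n ^ d))⁻¹ * ‖g ((h n)⁻¹ • v)‖ₑ * T v
      ≤ ∫⁻ v, (ENNReal.ofReal (h n ^ d))⁻¹ * η' * ‖g ((h n)⁻¹ • v)‖ₑ := by
        refine lintegral_mono fun v => ?_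
        rcases eq_or_ne (g ((h n)⁻¹ • v)) 0 with hz | hz
        · simp [hz]
        · have hv : ‖v‖ < r := by
            have := hρ _ hz
            rw [norm_smul, norm_inv, Real.norm_of_nonneg hn0.le, inv_mul_le_iff₀ hn0] at this
            rw [lt_div_iff₀ hρ0] at hn
            linarith
          have := hrT (y := v) (by simpa using hv)
          rw [mul_assoc, mul_assoc, mul_comm η']
          gcongr
    _ = η' * ∫⁻ u, ‖g u‖ₑ := by
        have hne : ENNReal.ofReal (h n ^ d) ≠ 0 := by simp [hn0]
        have hgm : Measurable fun v : 𝔼 => ‖g ((h n)⁻¹ • v)‖ₑ :=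
          (hg.measurable.comp (by fun_prop)).enorm
        rw [lintegral_const_mul _ hgm, lintegral_comp_inv_smul (fun u => ‖g u‖ₑ) hn0,
          mul_right_comm, ← mul_assoc, ENNReal.inv_mul_cancel hne ENNReal.ofReal_ne_top,
          one_mul, mul_comm]
    _ ≤ η := hη'2

variable {𝒴 : Type*} [MeasurableSpace 𝒴]

theorem measurable_jointDensity (P : Measure (𝔼 × 𝒴)) (y : 𝒴) :
    Measurable fun x => jointDensity P x y :=
  (Measure.measurable_rnDeriv _ _).ennreal_toReal

theorem integrable_jointDensity (P : Measure (𝔼 × 𝒴)) [IsFiniteMeasure P] (y : 𝒴) :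
    Integrable fun x => jointDensity P x y :=
  Measure.integrable_toReal_rnDeriv

theorem lintegral_enorm_jointDensity_le (P : Measure (𝔼 × 𝒴)) [IsProbabilityMeasure P] (y : 𝒴) :
    ∫⁻ x, ‖jointDensity P x y‖ₑ ≤ 1 := by
  calc ∫⁻ x, ‖jointDensity P x y‖ₑ
      ≤ ∫⁻ x, ((P.restrict (Prod.snd ⁻¹' {y})).map Prod.fst).rnDeriv volume x := by
        refine lintegral_mono fun x => ?_
        rw [jointDensity, Real.enorm_of_nonneg ENNReal.toReal_nonneg]
        exact ENNReal.ofReal_toReal_le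
    _ ≤ ((P.restrict (Prod.snd ⁻¹' {y})).map Prod.fst) Set.univ := Measure.lintegral_rnDeriv_le
    _ ≤ 1 := by
        rw [Measure.map_apply measurable_fst MeasurableSet.univ]
        exact (Measure.restrict_apply_le _ _).trans prob_le_one

theorem tendsto_measure_le_norm_fst (P : Measure (𝔼 × 𝒴)) [IsProbabilityMeasure P] :
    Tendsto (fun k : ℕ => P {z | (k : ℝ) ≤ ‖z.1‖}) atTop (𝓝 0) := by
  have hm : ∀ k : ℕ, MeasurableSet {z : 𝔼 × 𝒴 | (k : ℝ) ≤ ‖z.1‖} := fun k =>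
    measurableSet_le measurable_const measurable_fst.norm
  have := tendsto_measure_iInter_atTop (μ := P) (fun k => (hm k).nullMeasurableSet)
    (fun i j hij z hz => (Nat.cast_le.2 hij).trans (Set.mem_ofPred_eq ▸ hz)) ⟨0, measure_ne_top _ _⟩
  have h0 : ⋂ k : ℕ, {z : 𝔼 × 𝒴 | (k : ℝ) ≤ ‖z.1‖} = ∅ := by
    ext z
    simp only [Set.mem_iInter, Set.mem_ofPred_eq, Set.mem_empty_iff_false, iff_false, not_forall,
      not_le]
    exact exists_nat_gt _
  rwa [h0, measure_empty] at this

variable [MeasurableSingletonClass 𝒴]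

/-- Absolute continuity passes from the marginal of `P` to its part with outcome `y`, so that part
is integration against its density. -/
theorem integral_kernelWeight {P : Measure (𝔼 × 𝒴)} [IsProbabilityMeasure P]
    (hac : P.fst ≪ volume) {K : 𝔼 → ℝ} (hK : Measurable K) (h : ℝ) (y : 𝒴) (x : 𝔼) :
    ∫ z, kernelWeight K h y x z ∂P
      = ∫ a, ((h ^ d)⁻¹ * K (h⁻¹ • (a - x))) * jointDensity P a y := by
  have hyS : MeasurableSet (Prod.snd ⁻¹' {y} : Set (𝔼 × 𝒴)) :=
    measurable_snd (measurableSet_singleton y)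
  have hν : (P.restrict (Prod.snd ⁻¹' {y})).map Prod.fst ≪ volume :=
    (Measure.restrict_le_self.absolutelyContinuous.map measurable_fst).trans hac
  have h1 : ∫ z, kernelWeight K h y x z ∂P
      = ∫ z in Prod.snd ⁻¹' {y}, (h ^ d)⁻¹ * K (h⁻¹ • (z.1 - x)) ∂P := by
    rw [← integral_indicator hyS]
    refine integral_congr_ae (Eventually.of_forall fun z => ?_)
    by_cases hz : z.2 = y <;> simp [kernelWeight, hz]
  have hm : Measurable fun a : 𝔼 => (h ^ d)⁻¹ * K (h⁻¹ • (a - x)) :=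
    (hK.comp (by fun_prop)).const_mul _
  rw [h1, ← integral_map (f := fun a : 𝔼 => (h ^ d)⁻¹ * K (h⁻¹ • (a - x)))
    measurable_fst.aemeasurable hm.aestronglyMeasurable, ← integral_rnDeriv_smul hν]
  refine integral_congr_ae (Eventually.of_forall fun a => ?_)
  simp only [jointDensity, smul_eq_mul, mul_comm]

/-- The stochastic part of the kernel density estimate with a continuous compactly supported
kernel vanishes in mean `L¹` norm. -/
theorem tendsto_lintegral_sampleMean_kernelWeight_sub_mean {P : Measure (𝔼 × 𝒴)}
    [IsProbabilityMeasure P] {g : 𝔼 → ℝ} (hg : Continuous g) (hgs : HasCompactSupport g)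
    {h : ℕ → ℝ} (hpos : ∀ n, 0 < h n) (hh : Tendsto h atTop (𝓝 0))
    (hnh : Tendsto (fun n : ℕ => (n : ℝ) * h n ^ d) atTop atTop) (y : 𝒴) :
    Tendsto (fun n => ∫⁻ x, ∫⁻ z, ‖sampleMean n (kernelWeight g (h n) y x) z
      - ∫ s, kernelWeight g (h n) y x s ∂P‖ₑ ∂(Measure.pi fun _ => P)) atTop (𝓝 0) := by
  have hgi : Integrable g := hg.integrable_of_hasCompactSupport hgs
  obtain ⟨M, hM⟩ := hgs.exists_bound_of_continuous hg
  obtain ⟨ρ, hρ0, hρ⟩ : ∃ ρ : ℝ, 0 < ρ ∧ ∀ u, g u ≠ 0 → ‖u‖ ≤ ρ := by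
    obtain ⟨ρ, h1, h2⟩ := hgs.isCompact.isBounded.exists_pos_norm_le
    exact ⟨ρ, h1, fun u hu => h2 u (subset_tsupport g hu)⟩
  have hwm2 : ∀ n, Measurable fun q : 𝔼 × (𝔼 × 𝒴) => kernelWeight g (h n) y q.1 q.2 := fun n =>
    measurable_kernelWeight hg.measurable (h n) y
  have hwm : ∀ n x, Measurable (kernelWeight g (h n) y x) := fun n x =>
    (hwm2 n).comp (measurable_const.prodMk measurable_id)
  have hwL : ∀ n x, MemLp (kernelWeight g (h n) y x) 2 P := by
    intro n x
    refine MemLp.of_bound (hwm n x).aestronglyMeasurable (‖(h n ^ d)⁻¹‖ * M)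
      (Eventually.of_forall fun z => ?_)
    rw [kernelWeight, norm_mul, norm_mul]
    have h1 : ‖Set.indicator {y} (fun _ => (1 : ℝ)) z.2‖ ≤ 1 := by
      by_cases hz : z.2 ∈ ({y} : Set 𝒴) <;> simp [hz]
    calc _ ≤ 1 * (‖(h n ^ d)⁻¹‖ * M) := by
          gcongr
          exact hM _
      _ = _ := one_mul _
  set A : ℝ≥0∞ := ∫⁻ u, ‖g u‖ₑ with hA
  set B : ℝ≥0∞ := ∫⁻ u, ‖g u‖ₑ ^ 2 with hB
  have hAfin : A ≠ ∞ := hgi.2.ne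
  have hBfin : B ≠ ∞ := by
    have h1 : MemLp g 2 := hg.memLp_of_hasCompactSupport hgs
    have h2 := (eLpNorm_lt_top_iff_lintegral_rpow_enorm_lt_top two_ne_zero
      ENNReal.ofNat_ne_top).1 h1.2
    simpa using h2.ne
  have hEm : ∀ n, Measurable fun x => ∫⁻ z, ‖sampleMean n (kernelWeight g (h n) y x) z
      - ∫ s, kernelWeight g (h n) y x s ∂P‖ₑ ^ 2 ∂(Measure.pi fun _ => P) := by
    intro n
    refine Measurable.lintegral_prod_right' (f := fun q : 𝔼 × (Fin n → 𝔼 × 𝒴) =>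
      ‖sampleMean n (kernelWeight g (h n) y q.1) q.2 - ∫ s, kernelWeight g (h n) y q.1 s ∂P‖ₑ ^ 2) ?_
    refine (Measurable.sub ?_ ?_).enorm.pow_const 2
    · refine Measurable.const_mul (Finset.measurable_sum _ fun i _ => ?_) _
      exact (hwm2 n).comp (measurable_fst.prodMk ((measurable_pi_apply i).comp measurable_snd))
    · exact (hwm2 n).stronglyMeasurable.integral_prod_right'.measurable.comp measurable_fst
  -- Inside the ball the second moment is used through `δ`. Outside it, with bandwidth at most 1 and
  -- kernel support in radius `ρ`, only observations of norm at least `R` contribute.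
  have hbound : ∀ n : ℕ, n ≠ 0 → h n ≤ 1 → ∀ R : ℝ, ∀ δ : ℝ≥0∞, δ ≠ 0 → δ ≠ ∞ →
      ∫⁻ x, ∫⁻ z, ‖sampleMean n (kernelWeight g (h n) y x) z
        - ∫ s, kernelWeight g (h n) y x s ∂P‖ₑ ∂(Measure.pi fun _ => P)
      ≤ δ * volume (Metric.ball (0 : 𝔼) (R + ρ))
        + δ⁻¹ * (ENNReal.ofReal (n * h n ^ d))⁻¹ * B + 2 * (A * P {z | R ≤ ‖z.1‖}) := by
    intro n hn0 hn1 R δ hδ0 hδt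
    have hn := hpos n
    rw [← lintegral_add_compl _ (Metric.isOpen_ball (x := (0 : 𝔼)) (ε := R + ρ)).measurableSet]
    refine add_le_add ?_ ?_
    · calc ∫⁻ x in Metric.ball 0 (R + ρ), ∫⁻ z, ‖sampleMean n (kernelWeight g (h n) y x) z
            - ∫ s, kernelWeight g (h n) y x s ∂P‖ₑ ∂(Measure.pi fun _ => P)
          ≤ ∫⁻ x in Metric.ball 0 (R + ρ), (δ + δ⁻¹ *
            ∫⁻ z, ‖sampleMean n (kernelWeight g (h n) y x) z
            - ∫ s, kernelWeight g (h n) y x s ∂P‖ₑ ^ 2 ∂(Measure.pi fun _ => P)) := by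
            refine lintegral_mono fun x => ?_
            refine (lintegral_mono fun z => ENNReal.le_add_inv_mul_sq hδ0 hδt _).trans ?_
            rw [lintegral_add_left measurable_const, lintegral_const, measure_univ, mul_one,
              lintegral_const_mul' _ _ (ENNReal.inv_ne_top.2 hδ0)]
        _ ≤ δ * volume (Metric.ball (0 : 𝔼) (R + ρ)) + δ⁻¹ * ∫⁻ x,
            ∫⁻ z, ‖sampleMean n (kernelWeight g (h n) y x) z
            - ∫ s, kernelWeight g (h n) y x s ∂P‖ₑ ^ 2 ∂(Measure.pi fun _ => P) := by
            rw [lintegral_add_left measurable_const, setLIntegral_const,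
              lintegral_const_mul _ (hEm n)]
            gcongr
            exact Measure.restrict_le_self
        _ ≤ δ * volume (Metric.ball (0 : 𝔼) (R + ρ))
            + δ⁻¹ * ((ENNReal.ofReal (n * h n ^ d))⁻¹ * B) := by
            gcongr
            calc _ ≤ ∫⁻ x, (n : ℝ≥0∞)⁻¹ * ∫⁻ s, ‖kernelWeight g (h n) y x s‖ₑ ^ 2 ∂P :=
                  lintegral_mono fun x =>
                    lintegral_enorm_sampleMean_sub_integral_sq_le hn0 (hwL n x)
              _ = (n : ℝ≥0∞)⁻¹ * ∫⁻ s, (∫⁻ x, ‖kernelWeight g (h n) y x s‖ₑ ^ 2) ∂P := by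
                  rw [lintegral_const_mul' _ _ (by simpa using hn0), lintegral_lintegral_swap]
                  exact ((hwm2 n).enorm.pow_const 2).aemeasurable
              _ ≤ (n : ℝ≥0∞)⁻¹ * ∫⁻ s, (ENNReal.ofReal (h n ^ d))⁻¹ * B ∂P := by
                  gcongr with s
                  exact lintegral_enorm_kernelWeight_sq_le g hn y s
              _ = (ENNReal.ofReal (n * h n ^ d))⁻¹ * B := by
                  rw [lintegral_const, measure_univ, mul_one, ENNReal.ofReal_mul (by positivity),
                    ENNReal.mul_inv (Or.inr ENNReal.ofReal_ne_top)
                      (Or.inl ENNReal.ofReal_ne_top), ENNReal.ofReal_natCast, mul_assoc]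
        _ = _ := by rw [mul_assoc δ⁻¹]
    · calc ∫⁻ x in (Metric.ball 0 (R + ρ))ᶜ, ∫⁻ z, ‖sampleMean n (kernelWeight g (h n) y x) z
            - ∫ s, kernelWeight g (h n) y x s ∂P‖ₑ ∂(Measure.pi fun _ => P)
          ≤ ∫⁻ x in (Metric.ball 0 (R + ρ))ᶜ, 2 * ∫⁻ s, ‖kernelWeight g (h n) y x s‖ₑ ∂P :=
            lintegral_mono fun x => lintegral_enorm_sampleMean_sub_integral_le (hwm n x)
        _ = 2 * ∫⁻ s, (∫⁻ x in (Metric.ball 0 (R + ρ))ᶜ, ‖kernelWeight g (h n) y x s‖ₑ) ∂P := by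
            rw [lintegral_const_mul' _ _ ENNReal.ofNat_ne_top, lintegral_lintegral_swap]
            exact (hwm2 n).enorm.aemeasurable
        _ ≤ 2 * ∫⁻ s, ({z : 𝔼 × 𝒴 | R ≤ ‖z.1‖}.indicator (fun _ => A)) s ∂P := by
            gcongr with s
            by_cases hs : R ≤ ‖s.1‖
            · rw [Set.indicator_of_mem (by exact hs)]
              exact (setLIntegral_le_lintegral _ _).trans (lintegral_enorm_kernelWeight_le g hn y s)
            · rw [Set.indicator_of_notMem (by exact hs), nonpos_iff_eq_zero]
              refine (setLIntegral_congr_fun (g := fun _ => 0)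
                Metric.isOpen_ball.measurableSet.compl fun x hx => ?_).trans lintegral_zero
              have hx' : R + ρ ≤ ‖x‖ := by simpa using hx
              have hz : g ((h n)⁻¹ • (s.1 - x)) = 0 := by
                by_contra hne
                have := hρ _ hne
                rw [norm_smul, norm_inv, Real.norm_of_nonneg hn.le, inv_mul_le_iff₀ hn] at this
                have h3 : h n * ρ ≤ ρ := mul_le_of_le_one_left hρ0.le hn1
                have h4 := norm_sub_norm_le x s.1
                rw [norm_sub_rev] at h4
                linarith [not_le.1 hs]
              simp [kernelWeight, hz]
        _ = 2 * (A * P {z | R ≤ ‖z.1‖}) := by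
            rw [lintegral_indicator_const (measurableSet_le measurable_const measurable_fst.norm)]
  rw [ENNReal.tendsto_nhds_zero]
  intro η hη
  have hη3 : 0 < η / 3 := ENNReal.div_pos hη.ne' ENNReal.ofNat_ne_top
  -- The order of choice matters: the radius `k` from tightness, then `δ` from the volume of that
  -- ball, and only then `n` large.
  obtain ⟨k, hk⟩ : ∃ k : ℕ, 2 * (A * P {z | (k : ℝ) ≤ ‖z.1‖}) ≤ η / 3 := by
    have h1 : Tendsto (fun k : ℕ => 2 * (A * P {z | (k : ℝ) ≤ ‖z.1‖})) atTop (𝓝 0) := by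
      have := ENNReal.Tendsto.const_mul (a := 2) (ENNReal.Tendsto.const_mul (a := A)
        (tendsto_measure_le_norm_fst P) (Or.inr hAfin)) (Or.inr ENNReal.ofNat_ne_top)
      simpa using this
    exact (ENNReal.tendsto_nhds_zero.1 h1 _ hη3).exists
  obtain ⟨δ, hδ0, hδ⟩ := ENNReal.exists_nnreal_pos_mul_lt
    (measure_ball_lt_top (μ := (volume : Measure 𝔼)) (x := 0) (r := k + ρ)).ne hη3.ne'
  have hδ0' : (δ : ℝ≥0∞) ≠ 0 := by exact_mod_cast hδ0.ne'
  have hvar : Tendsto (fun n : ℕ => (δ : ℝ≥0∞)⁻¹ * (ENNReal.ofReal (n * h n ^ d))⁻¹ * B) atTop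
      (𝓝 0) := by
    have h1 : Tendsto (fun n : ℕ => (ENNReal.ofReal (n * h n ^ d))⁻¹) atTop (𝓝 0) := by
      simpa using tendsto_inv_iff.2 (ENNReal.tendsto_ofReal_atTop.comp hnh)
    have h2 := ENNReal.Tendsto.mul_const (b := B) (ENNReal.Tendsto.const_mul (a := (δ : ℝ≥0∞)⁻¹) h1
      (Or.inr (ENNReal.inv_ne_top.2 hδ0'))) (Or.inr hBfin)
    simpa using h2
  filter_upwards [eventually_ne_atTop 0, hh.eventually_le_const one_pos,
    ENNReal.tendsto_nhds_zero.1 hvar _ hη3] with n hn0 hn1 hn2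
  refine (hbound n hn0 hn1 k δ hδ0' ENNReal.coe_ne_top).trans ?_
  calc _ ≤ η / 3 + η / 3 + η / 3 := by gcongr
    _ = η := ENNReal.add_thirds η

end KernelMean

/-! ### From convergence in mean to almost sure convergence. -/

/-- Nonnegative statistics of an i.i.d. sample that change by at most `c / n` when one of the `n`
observations is changed, and whose means tend to zero, tend to zero almost surely. -/
theorem IsIIDSample.tendsto_zero_of_bounded_differences {Ω S : Type*} [MeasurableSpace Ω]
    [MeasurableSpace S] {μ : Measure Ω} [IsProbabilityMeasure μ] {P : Measure S}
    [IsProbabilityMeasure P] {Z : ℕ → Ω → S} (hZ : IsIIDSample Z P μ)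
    {F : ∀ n : ℕ, (Fin n → S) → ℝ} (hF : ∀ n, Measurable (F n)) (hF0 : ∀ n z, 0 ≤ F n z)
    (hFb : ∀ n, ∃ C : ℝ, ∀ z, F n z ≤ C) {c : NNReal} (hc : c ≠ 0)
    (hdiff : ∀ n z i s, |F n (Function.update z i s) - F n z| ≤ c / n)
    (hmean : Tendsto (fun n => ∫ z, F n z ∂(Measure.pi fun _ => P)) atTop (𝓝 0)) :
    ∀ᵐ ω ∂μ, Tendsto (fun n => F n fun i => Z i ω) atTop (𝓝 0) := by
  have hlaw : ∀ n : ℕ, μ.map (fun ω (i : Fin n) => Z i ω) = Measure.pi fun _ => P := by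
    intro n
    have h1 : iIndepFun (fun (i : Fin n) => Z i) μ := hZ.indep.precomp Fin.val_injective
    rw [(iIndepFun_iff_map_fun_eq_pi_map fun i : Fin n => (hZ.law i).aemeasurable).1 h1]
    simp only [(hZ.law _).map_eq]
  have hZm : ∀ n : ℕ, AEMeasurable (fun ω (i : Fin n) => Z i ω) μ := fun n =>
    aemeasurable_pi_lambda _ fun i => (hZ.law i).aemeasurable
  -- With differences `c / n` the variance proxy is n(c/n)² = c²/n, so the tail is geometric in `n`
  -- and summable for Borel–Cantelli. Nonnegativity of `F` makes the upper tail sufficient.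
  have htail : ∀ (n : ℕ) (t : ℝ), 0 < t →
      μ {ω | t ≤ F n (fun i => Z i ω) - ∫ z, F n z ∂(Measure.pi fun _ => P)}
        ≤ ENNReal.ofReal (Real.exp (n * (-t ^ 2 / (2 * c ^ 2)))) := by
    intro n t ht
    obtain ⟨C, hC⟩ := hFb n
    have hsub := hasSubgaussianMGF_of_bounded_differences P (c / n) n (F n) (hF n) C
      (fun z => by rw [abs_of_nonneg (hF0 n z)]; exact hC z)
      (fun z i s => by simpa using hdiff n z i s)
    have h1 := hsub.measure_ge_le ht.le
    have hset : MeasurableSet {z | t ≤ F n z - ∫ z, F n z ∂(Measure.pi fun _ => P)} :=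
      measurableSet_le measurable_const ((hF n).sub_const _)
    have h2 : μ {ω | t ≤ F n (fun i => Z i ω) - ∫ z, F n z ∂(Measure.pi fun _ => P)}
        = (Measure.pi fun _ => P) {z | t ≤ F n z - ∫ z, F n z ∂(Measure.pi fun _ => P)} := by
      rw [← hlaw n, Measure.map_apply_of_aemeasurable (hZm n) (by rwa [hlaw n])]
      rfl
    rw [h2, ← ofReal_measureReal]
    refine ENNReal.ofReal_le_ofReal (h1.trans (le_of_eq ?_))
    congr 1
    rcases Nat.eq_zero_or_pos n with rfl | hn
    · simp
    · have hc' : (c : ℝ) ≠ 0 := by exact_mod_cast hc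
      push_cast
      field_simp
  have hae : ∀ᵐ ω ∂μ, ∀ k : ℕ, ∀ᶠ n in atTop,
      F n (fun i => Z i ω) - ∫ z, F n z ∂(Measure.pi fun _ => P) < 1 / (k + 1 : ℝ) := by
    rw [ae_all_iff]
    intro k
    have ht : 0 < 1 / (k + 1 : ℝ) := Nat.one_div_pos_of_nat
    have hsum : ∑' n : ℕ, μ {ω | 1 / (k + 1 : ℝ) ≤ F n (fun i => Z i ω)
        - ∫ z, F n z ∂(Measure.pi fun _ => P)} ≠ ∞ := by
      refine ne_top_of_le_ne_top ?_ (ENNReal.tsum_le_tsum fun n => htail n _ ht)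
      refine Summable.tsum_ofReal_ne_top (Real.summable_exp_nat_mul_iff.2 ?_)
      have hc' : (0 : ℝ) < c := by exact_mod_cast pos_iff_ne_zero.2 hc
      rw [neg_div]
      exact neg_neg_of_pos (by positivity)
    filter_upwards [ae_eventually_notMem hsum] with ω hω
    exact hω.mono fun n hn => not_le.1 hn
  filter_upwards [hae] with ω hω
  refine tendsto_order.2 ⟨fun a ha => Eventually.of_forall fun n => ha.trans_le (hF0 n _),
    fun a ha => ?_⟩
  obtain ⟨k, hk⟩ := exists_nat_one_div_lt (half_pos ha)
  filter_upwards [hω k, hmean.eventually_lt_const (half_pos ha)] with n h1 h2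
  linarith

theorem sampleMean_update {S : Type*} {n : ℕ} (w : S → ℝ) (z : Fin n → S) (i : Fin n) (s : S) :
    sampleMean n w (Function.update z i s) = sampleMean n w z + (n : ℝ)⁻¹ * (w s - w (z i)) := by
  have h1 : ∀ j, w (Function.update z i s j) = Function.update (w ∘ z) i (w s) j := fun j => by
    rw [← Function.comp_update]; rfl
  have h2 := Finset.add_sum_erase Finset.univ (fun j => w (z j)) (Finset.mem_univ i)
  simp only [sampleMean, h1]
  rw [Finset.sum_update_of_mem (Finset.mem_univ i), ← h2, Finset.sdiff_singleton_eq_erase]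
  simp only [Function.comp_apply]
  ring

/-! ### Strong L¹ consistency for a general kernel. -/

section KernelEstimate

variable {d : ℕ} {𝒴 : Type*}

local notation "𝔼" => EuclideanSpace ℝ (Fin d)

theorem sampleMean_kernelWeight_sub {n : ℕ} (K g : 𝔼 → ℝ) (h : ℝ) (y : 𝒴) (x : 𝔼)
    (z : Fin n → 𝔼 × 𝒴) :
    sampleMean n (kernelWeight (fun u => K u - g u) h y x) z
      = sampleMean n (kernelWeight K h y x) z - sampleMean n (kernelWeight g h y x) z := by
  simp only [sampleMean, kernelWeight, mul_sub, Finset.sum_sub_distrib]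

variable [MeasurableSpace 𝒴] [MeasurableSingletonClass 𝒴]

theorem measurable_sampleMean_kernelWeight {K : 𝔼 → ℝ} (hK : Measurable K) (h : ℝ) (y : 𝒴)
    (n : ℕ) :
    Measurable fun q : 𝔼 × (Fin n → 𝔼 × 𝒴) => sampleMean n (kernelWeight K h y q.1) q.2 := by
  refine Measurable.const_mul (Finset.measurable_sum _ fun i _ => ?_) _
  exact (measurable_kernelWeight hK h y).comp
    (measurable_fst.prodMk ((measurable_pi_apply i).comp measurable_snd))

theorem integrable_kernelWeight {K : 𝔼 → ℝ} (hK : Measurable K) (hKi : Integrable K) {h : ℝ}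
    (hh : 0 < h) (y : 𝒴) (z : 𝔼 × 𝒴) : Integrable fun x => kernelWeight K h y x z :=
  ⟨((measurable_kernelWeight hK h y).comp
    (measurable_id.prodMk measurable_const)).aestronglyMeasurable,
    (lintegral_enorm_kernelWeight_le K hh y z).trans_lt hKi.2⟩

theorem integral_norm_kernelWeight_le {K : 𝔼 → ℝ} (hK : Measurable K) (hKi : Integrable K) {h : ℝ}
    (hh : 0 < h) (y : 𝒴) (z : 𝔼 × 𝒴) : ∫ x, ‖kernelWeight K h y x z‖ ≤ ∫ u, ‖K u‖ := by
  rw [integral_norm_eq_lintegral_enorm (integrable_kernelWeight hK hKi hh y z).1,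
    integral_norm_eq_lintegral_enorm hKi.1]
  exact ENNReal.toReal_mono hKi.2.ne (lintegral_enorm_kernelWeight_le K hh y z)

theorem integrable_sampleMean_kernelWeight {K : 𝔼 → ℝ} (hK : Measurable K) (hKi : Integrable K)
    {h : ℝ} (hh : 0 < h) (y : 𝒴) {n : ℕ} (z : Fin n → 𝔼 × 𝒴) :
    Integrable fun x => sampleMean n (kernelWeight K h y x) z :=
  (integrable_finsetSum _ fun i _ => integrable_kernelWeight hK hKi hh y (z i)).const_mul _

/-- The mean `L¹` error of the joint kernel density estimate tends to zero. -/
theorem tendsto_lintegral_sampleMean_kernelWeight_sub_jointDensity {P : Measure (𝔼 × 𝒴)}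
    [IsProbabilityMeasure P] (hac : P.fst ≪ volume) {K : 𝔼 → ℝ} (hK : Measurable K)
    (hK1 : ∫ u, K u = 1) {h : ℕ → ℝ} (hpos : ∀ n, 0 < h n) (hh : Tendsto h atTop (𝓝 0))
    (hnh : Tendsto (fun n : ℕ => (n : ℝ) * h n ^ d) atTop atTop) (y : 𝒴) :
    Tendsto (fun n => ∫⁻ x, ∫⁻ z, ‖sampleMean n (kernelWeight K (h n) y x) z
      - jointDensity P x y‖ₑ ∂(Measure.pi fun _ => P)) atTop (𝓝 0) := by
  -- A non-integrable function has Bochner integral `0`, so integral `1` forces integrability.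
  have hKi : Integrable K := Integrable.of_integral_ne_zero (by simp [hK1])
  rw [ENNReal.tendsto_nhds_zero]
  intro η hη
  have hη4 : 0 < η / 4 := ENNReal.div_pos hη.ne' ENNReal.ofNat_ne_top
  obtain ⟨g, hgs, hgK, hg, hgi⟩ := hKi.exists_hasCompactSupport_lintegral_sub_le hη4.ne'
  have hp := integrable_jointDensity P y
  have hpm := measurable_jointDensity P y
  have hbias := tendsto_lintegral_enorm_smoothing_sub hpm hp hg hgs hpos hh
  have hstoch := tendsto_lintegral_sampleMean_kernelWeight_sub_mean (P := P) hg hgs hpos hh hnh y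
  have hKgm : Measurable fun u => K u - g u := hK.sub hg.measurable
  filter_upwards [ENNReal.tendsto_nhds_zero.1 hbias _ hη4,
    ENNReal.tendsto_nhds_zero.1 hstoch _ hη4] with n hn1 hn2
  simp_rw [← integral_kernelWeight hac hg.measurable] at hn1
  have hn0 := hpos n
  have hmean : Measurable fun x => ∫ s, kernelWeight g (h n) y x s ∂P :=
    (measurable_kernelWeight hg.measurable (h n) y).stronglyMeasurable.integral_prod_right'.measurable
  have hsec : ∀ x, Measurable (kernelWeight g (h n) y x) := fun x =>
    (measurable_kernelWeight hg.measurable (h n) y).comp (measurable_const.prodMk measurable_id)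
  have hsec' : ∀ x, Measurable (kernelWeight (fun u => K u - g u) (h n) y x) := fun x =>
    (measurable_kernelWeight hKgm (h n) y).comp (measurable_const.prodMk measurable_id)
  -- Four errors, each at most `η / 4` once integrated in `x`: replacing `K` by `g`, the fluctuation
  -- and the bias for `g`, and the defect of `∫ g` from 1.
  have hpt : ∀ x, ∫⁻ z, ‖sampleMean n (kernelWeight K (h n) y x) z
      - jointDensity P x y‖ₑ ∂(Measure.pi fun _ => P)
      ≤ ∫⁻ s, ‖kernelWeight (fun u => K u - g u) (h n) y x s‖ₑ ∂P
        + ∫⁻ z, ‖sampleMean n (kernelWeight g (h n) y x) z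
          - ∫ s, kernelWeight g (h n) y x s ∂P‖ₑ ∂(Measure.pi fun _ => P)
        + ‖∫ s, kernelWeight g (h n) y x s ∂P - (∫ u, g u) * jointDensity P x y‖ₑ
        + ‖(∫ u, g u) - 1‖ₑ * ‖jointDensity P x y‖ₑ := by
    intro x
    calc ∫⁻ z, ‖sampleMean n (kernelWeight K (h n) y x) z
          - jointDensity P x y‖ₑ ∂(Measure.pi fun _ => P)
        ≤ ∫⁻ z, (‖sampleMean n (kernelWeight (fun u => K u - g u) (h n) y x) z‖ₑ
          + ‖sampleMean n (kernelWeight g (h n) y x) z - ∫ s, kernelWeight g (h n) y x s ∂P‖ₑ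
          + ‖∫ s, kernelWeight g (h n) y x s ∂P - (∫ u, g u) * jointDensity P x y‖ₑ
          + ‖(∫ u, g u) - 1‖ₑ * ‖jointDensity P x y‖ₑ) ∂(Measure.pi fun _ => P) := by
          refine lintegral_mono fun z => ?_
          rw [← enorm_mul]
          refine le_trans (le_of_eq ?_) ((enorm_add_le _ _).trans (add_le_add_left
            ((enorm_add_le _ _).trans (add_le_add_left (enorm_add_le _ _) _)) _))
          rw [sampleMean_kernelWeight_sub]
          ring_nf
      _ ≤ _ := by
          rw [lintegral_add_right _ measurable_const, lintegral_add_right _ measurable_const,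
            lintegral_add_left (measurable_sampleMean (hsec' x)).enorm]
          simp only [lintegral_const, measure_univ, mul_one]
          gcongr
          exact lintegral_enorm_sampleMean_le (hsec' x)
  have h1 : ∫⁻ x, ∫⁻ s, ‖kernelWeight (fun u => K u - g u) (h n) y x s‖ₑ ∂P ≤ η / 4 := by
    rw [lintegral_lintegral_swap (measurable_kernelWeight hKgm (h n) y).enorm.aemeasurable]
    calc _ ≤ ∫⁻ _s, η / 4 ∂P := lintegral_mono fun s =>
          (lintegral_enorm_kernelWeight_le _ hn0 y s).trans hgK
      _ = η / 4 := by simp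
  have h4 : ∫⁻ x, ‖(∫ u, g u) - 1‖ₑ * ‖jointDensity P x y‖ₑ ≤ η / 4 := by
    rw [lintegral_const_mul _ hpm.enorm, ← hK1, ← integral_sub hgi hKi]
    calc _ ≤ (η / 4) * 1 := by
          gcongr
          · refine (enorm_integral_le_lintegral_enorm _).trans (le_trans (le_of_eq ?_) hgK)
            exact lintegral_congr fun u => by rw [← enorm_neg, neg_sub]
          · exact lintegral_enorm_jointDensity_le P y
      _ = η / 4 := mul_one _
  have hm3 : Measurable fun x => ‖∫ s, kernelWeight g (h n) y x s ∂P
      - (∫ u, g u) * jointDensity P x y‖ₑ := (hmean.sub (hpm.const_mul _)).enorm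
  have hm1 : Measurable fun x => ∫⁻ s, ‖kernelWeight (fun u => K u - g u) (h n) y x s‖ₑ ∂P :=
    (measurable_kernelWeight hKgm (h n) y).enorm.lintegral_prod_right'
  refine (lintegral_mono hpt).trans ?_
  rw [lintegral_add_right _ (hpm.enorm.const_mul _), lintegral_add_right _ hm3,
    lintegral_add_left hm1]
  calc _ ≤ η / 4 + η / 4 + η / 4 + η / 4 := by gcongr
    _ = 4 * (η / 4) := by ring
    _ = η := ENNReal.mul_div_cancel (by norm_num) ENNReal.ofNat_ne_top

/-- Strong `L¹` consistency of the joint kernel density estimate, for a measurable kernel. -/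
theorem IsIIDSample.tendsto_integral_sampleMean_kernelWeight {Ω : Type*} [MeasurableSpace Ω]
    {μ : Measure Ω} [IsProbabilityMeasure μ] {P : Measure (𝔼 × 𝒴)} [IsProbabilityMeasure P]
    (hac : P.fst ≪ volume) {Z : ℕ → Ω → 𝔼 × 𝒴} (hZ : IsIIDSample Z P μ) {K : 𝔼 → ℝ}
    (hK : Measurable K) (hK1 : ∫ u, K u = 1) {h : ℕ → ℝ} (hpos : ∀ n, 0 < h n)
    (hh : Tendsto h atTop (𝓝 0)) (hnh : Tendsto (fun n : ℕ => (n : ℝ) * h n ^ d) atTop atTop)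
    (y : 𝒴) :
    ∀ᵐ ω ∂μ, Tendsto (fun n => ∫ x, |sampleMean n (kernelWeight K (h n) y x) (fun i => Z i ω)
      - jointDensity P x y|) atTop (𝓝 0) := by
  have hKi : Integrable K := Integrable.of_integral_ne_zero (by simp [hK1])
  have hp := integrable_jointDensity P y
  have hpm := measurable_jointDensity P y
  have hsm : ∀ n (z : Fin n → 𝔼 × 𝒴), Integrable fun x => sampleMean n (kernelWeight K (h n) y x) z :=
    fun n z => integrable_sampleMean_kernelWeight hK hKi (hpos n) y z
  have hjoint : ∀ n, Measurable fun q : 𝔼 × (Fin n → 𝔼 × 𝒴) =>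
      sampleMean n (kernelWeight K (h n) y q.1) q.2 - jointDensity P q.1 y := fun n =>
    (measurable_sampleMean_kernelWeight hK (h n) y n).sub (hpm.comp measurable_fst)
  set A : NNReal := ⟨∫ u, ‖K u‖, integral_nonneg fun _ => norm_nonneg _⟩ with hA
  have hA1 : (1 : ℝ) ≤ A := by
    have := norm_integral_le_integral_norm K (μ := volume)
    rwa [hK1, norm_one] at this
  have hA0 : A ≠ 0 := by
    rintro h0
    rw [h0] at hA1
    norm_num at hA1
  have hkw : ∀ n (s : 𝔼 × 𝒴), ∫ x, ‖kernelWeight K (h n) y x s‖ ≤ A := fun n s =>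
    integral_norm_kernelWeight_le hK hKi (hpos n) y s
  have hdi : ∀ n (z : Fin n → 𝔼 × 𝒴), Integrable fun x =>
      |sampleMean n (kernelWeight K (h n) y x) z - jointDensity P x y| := fun n z =>
    ((hsm n z).sub hp).abs
  have hkwi : ∀ n (s : 𝔼 × 𝒴), Integrable fun x => kernelWeight K (h n) y x s := fun n s =>
    integrable_kernelWeight hK hKi (hpos n) y s
  have hFm : ∀ n, Measurable fun z : Fin n → 𝔼 × 𝒴 =>
      ∫ x, |sampleMean n (kernelWeight K (h n) y x) z - jointDensity P x y| := fun n =>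
    ((hjoint n).norm.comp measurable_swap).stronglyMeasurable.integral_prod_right'.measurable
  have hFb : ∀ n, ∃ C : ℝ, ∀ z : Fin n → 𝔼 × 𝒴,
      ∫ x, |sampleMean n (kernelWeight K (h n) y x) z - jointDensity P x y| ≤ C := by
    intro n
    refine ⟨(n : ℝ)⁻¹ * ∑ _i : Fin n, (A : ℝ) + ∫ x, |jointDensity P x y|, fun z => ?_⟩
    calc ∫ x, |sampleMean n (kernelWeight K (h n) y x) z - jointDensity P x y|
        ≤ ∫ x, ((n : ℝ)⁻¹ * ∑ i, ‖kernelWeight K (h n) y x (z i)‖ + |jointDensity P x y|) := by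
          refine integral_mono (hdi n z)
            (((integrable_finsetSum _ fun i _ => (hkwi n (z i)).norm).const_mul _).add hp.abs)
            fun x => (abs_sub _ _).trans ?_
          gcongr
          rw [sampleMean, abs_mul, abs_of_nonneg (by positivity : (0 : ℝ) ≤ (n : ℝ)⁻¹)]
          gcongr
          exact Finset.abs_sum_le_sum_abs _ _
      _ = (n : ℝ)⁻¹ * ∑ i, (∫ x, ‖kernelWeight K (h n) y x (z i)‖) + ∫ x, |jointDensity P x y| := by
          rw [integral_add ((integrable_finsetSum _ fun i _ => (hkwi n (z i)).norm).const_mul _)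
            hp.abs, integral_const_mul, integral_finsetSum _ fun i _ => (hkwi n (z i)).norm]
      _ ≤ _ := by
          gcongr with i
          exact hkw n (z i)
  refine hZ.tendsto_zero_of_bounded_differences
    (F := fun n z => ∫ x, |sampleMean n (kernelWeight K (h n) y x) z - jointDensity P x y|)
    hFm (fun n z => integral_nonneg fun x => abs_nonneg _) hFb (c := 2 * A)
    (mul_ne_zero two_ne_zero hA0) ?_ ?_
  -- Replacing one observation exchanges two kernel bumps of weight 1/n, each of L¹ norm at most
  -- `A`; hence `c = 2 * A`.
  · intro n z i s
    rw [← integral_sub (hdi n _) (hdi n _)]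
    calc _ ≤ ∫ x, (n : ℝ)⁻¹ * (‖kernelWeight K (h n) y x s‖ + ‖kernelWeight K (h n) y x (z i)‖) := by
          refine abs_integral_le_integral_abs.trans (integral_mono
            ((hdi n _).sub (hdi n _)).abs
            (((hkwi n s).norm.add (hkwi n (z i)).norm).const_mul _) fun x => ?_)
          refine (abs_abs_sub_abs_le_abs_sub _ _).trans ?_
          rw [sub_sub_sub_cancel_right, sampleMean_update, add_sub_cancel_left, abs_mul,
            abs_of_nonneg (by positivity : (0 : ℝ) ≤ (n : ℝ)⁻¹)]
          gcongr
          exact abs_sub _ _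
      _ ≤ (n : ℝ)⁻¹ * (A + A) := by
          rw [integral_const_mul, integral_add (hkwi n s).norm (hkwi n (z i)).norm]
          gcongr
          · exact hkw n s
          · exact hkw n (z i)
      _ = _ := by push_cast; ring
  · have key := tendsto_lintegral_sampleMean_kernelWeight_sub_jointDensity hac hK hK1 hpos hh hnh y
    have key2 := (ENNReal.tendsto_toReal ENNReal.zero_ne_top).comp key
    refine key2.congr fun n => ?_
    rw [Function.comp_apply, lintegral_lintegral_swap (hjoint n).enorm.aemeasurable,
      integral_eq_lintegral_of_nonneg_ae
        (Eventually.of_forall fun z => integral_nonneg fun x => abs_nonneg _)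
        (hFm n).aestronglyMeasurable]
    congr 1
    refine lintegral_congr fun z => ?_
    rw [ofReal_integral_eq_lintegral_ofReal (hdi n z)
      (Eventually.of_forall fun x => abs_nonneg _)]
    exact lintegral_congr fun x => Real.enorm_eq_ofReal_abs _

/-- Lets `K` be replaced by a measurable representative: reflecting, translating and scaling pull
null sets back to null sets, and there are countably many observations. -/
theorem kernelEstimate_congr_ae {Ω 𝒴 : Type*} {K K' : 𝔼 → ℝ} (hK : K =ᵐ[volume] K') {h : ℝ}
    (hh : 0 < h) (Z : ℕ → Ω → 𝔼 × 𝒴) (n : ℕ) (ω : Ω) (y : 𝒴) :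
    (fun x => kernelEstimate K h Z n ω x y) =ᵐ[volume] fun x => kernelEstimate K' h Z n ω x y := by
  have hq : ∀ a : 𝔼, Measure.QuasiMeasurePreserving (fun x : 𝔼 => h⁻¹ • (a - x)) := fun a =>
    (Measure.quasiMeasurePreserving_smul volume (inv_ne_zero hh.ne')).comp
      (Measure.measurePreserving_sub_left volume a).quasiMeasurePreserving
  have hall : ∀ᵐ x, ∀ i, K (h⁻¹ • ((Z i ω).1 - x)) = K' (h⁻¹ • ((Z i ω).1 - x)) :=
    ae_all_iff.2 fun i => (hq (Z i ω).1).ae_eq_comp hK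
  filter_upwards [hall] with x hx
  simp only [kernelEstimate, hx]

end KernelEstimate

/-- Strong `L¹` consistency of the joint kernel density estimate. -/
theorem IsIIDSample.tendsto_integral_kernelEstimate {d : ℕ} {Ω 𝒴 : Type*} [MeasurableSpace Ω]
    [MeasurableSpace 𝒴] [MeasurableSingletonClass 𝒴] {μ : Measure Ω} [IsProbabilityMeasure μ]
    {P : Measure (EuclideanSpace ℝ (Fin d) × 𝒴)} [IsProbabilityMeasure P]
    (hac : P.fst ≪ volume) {Z : ℕ → Ω → EuclideanSpace ℝ (Fin d) × 𝒴} (hZ : IsIIDSample Z P μ)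
    {K : EuclideanSpace ℝ (Fin d) → ℝ} (hK1 : ∫ u, K u = 1) {h : ℕ → ℝ} (hpos : ∀ n, 0 < h n)
    (hh : Tendsto h atTop (𝓝 0)) (hnh : Tendsto (fun n : ℕ => (n : ℝ) * h n ^ d) atTop atTop)
    (y : 𝒴) :
    ∀ᵐ ω ∂μ, Tendsto (fun n => ∫ x, |kernelEstimate K (h n) Z n ω x y - jointDensity P x y|)
      atTop (𝓝 0) := by
  have hKi : Integrable K := Integrable.of_integral_ne_zero (by simp [hK1])
  have hmk := hKi.1.ae_eq_mk
  have hmk1 : ∫ u, hKi.1.mk K u = 1 := by rw [← integral_congr_ae hmk, hK1]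
  filter_upwards [hZ.tendsto_integral_sampleMean_kernelWeight hac
    hKi.1.stronglyMeasurable_mk.measurable hmk1 hpos hh hnh y] with ω hω
  refine hω.congr fun n => integral_congr_ae ?_
  filter_upwards [kernelEstimate_congr_ae hmk (hpos n) Z n ω y] with x hx
  rw [hx, kernelEstimate_eq_sampleMean]

theorem integrable_kernelEstimate {d : ℕ} {Ω 𝒴 : Type*} {K : EuclideanSpace ℝ (Fin d) → ℝ}
    (hK : Integrable K) {h : ℝ} (hh : 0 < h) (Z : ℕ → Ω → EuclideanSpace ℝ (Fin d) × 𝒴) (n : ℕ)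
    (ω : Ω) (y : 𝒴) : Integrable fun x => kernelEstimate K h Z n ω x y :=
  (integrable_finsetSum _ fun i _ => (((hK.comp_smul (inv_ne_zero hh.ne')).comp_sub_left
    (Z i ω).1).const_mul _).const_mul _).const_mul _

theorem tvdCont_le_sum_integral {d : ℕ} {𝒴 : Type*} [Fintype 𝒴]
    (D : Set (EuclideanSpace ℝ (Fin d))) {g p : EuclideanSpace ℝ (Fin d) → 𝒴 → ℝ}
    (hg : ∀ y, Integrable fun x => g x y) (hp : ∀ y, Integrable fun x => p x y) :
    tvdCont D g p ≤ ∑ y, ∫ x, |g x y - p x y| := by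
  have hi : ∀ y, Integrable fun x => |g x y - p x y| := fun y => ((hg y).sub (hp y)).abs
  rw [tvdCont, ← integral_finsetSum _ fun y _ => hi y]
  exact setIntegral_le_integral (integrable_finsetSum _ fun y _ => hi y)
    (Eventually.of_forall fun x => Finset.sum_nonneg fun y _ => abs_nonneg _)

theorem outcomeCount_le {Ω 𝒳 𝒴 : Type*} (Z : ℕ → Ω → 𝒳 × 𝒴) (n : ℕ) (ω : Ω) (y : 𝒴) :
    outcomeCount Z n ω y ≤ n := by
  calc outcomeCount Z n ω y ≤ ∑ _i ∈ Finset.range n, 1 :=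
        Finset.sum_le_sum fun i _ => Set.indicator_le_self' (fun _ _ => zero_le_one) _
    _ = n := by simp

/-- Any single outcome count is at most `n`, so large minimal counts force large `n`; limits along
`atTop` thus transfer to this filter. -/
theorem comap_iInf_outcomeCount_le {Ω 𝒳 𝒴 : Type*} [Nonempty 𝒴] (Z : ℕ → Ω → 𝒳 × 𝒴) (ω : Ω) :
    comap (fun n => ⨅ y, outcomeCount Z n ω y) atTop ≤ atTop := by
  obtain ⟨y⟩ := ‹Nonempty 𝒴›
  refine tendsto_id'.1 (tendsto_atTop_mono (fun n => ?_) tendsto_comap)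
  exact (ciInf_le (OrderBot.bddBelow _) y).trans (outcomeCount_le Z n ω y)

theorem proposition4
    {Ω : Type*} [MeasurableSpace Ω] (μ : Measure Ω) [IsProbabilityMeasure μ]
    {𝒴 : Type*} [Fintype 𝒴] [MeasurableSpace 𝒴] [MeasurableSingletonClass 𝒴]
    {q : ℕ} (Θ : Set (EuclideanSpace ℝ (Fin q))) :
    -- discrete covariates
    (∀ {𝒳 : Type*} [Fintype 𝒳] [MeasurableSpace 𝒳] [MeasurableSingletonClass 𝒳]
      (P : Measure (𝒳 × 𝒴)) [IsProbabilityMeasure P]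
      (Z : ℕ → Ω → 𝒳 × 𝒴) (_hZ : IsIIDSample Z P μ)
      (f : EuclideanSpace ℝ (Fin q) → 𝒳 → 𝒴 → ℝ)
      (_hf : ∀ θ ∈ Θ, IsCondMass Set.univ (f θ))
      (θstar : EuclideanSpace ℝ (Fin q)) (ε : ℝ)
      (_hreg : RegularityAssumption μ Θ
        (fun θ => tvdDiscrete (jointMass P) (hybrid (f θ) (jointMass P)))
        (fun n ω θ => tvdDiscrete (empiricalMass Z n ω) (hybrid (f θ) (empiricalMass Z n ω)))
        θstar ε)
      (θhat : ℕ → Ω → EuclideanSpace ℝ (Fin q))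
      (_hθ : ∀ᵐ ω ∂μ, ∀ᶠ n in atTop, IsUniqueMinimizer Θ
        (fun θ => tvdDiscrete (empiricalMass Z n ω) (hybrid (f θ) (empiricalMass Z n ω)))
        (θhat n ω)),
      ∀ᵐ ω ∂μ, Tendsto (fun n => θhat n ω) atTop (𝓝 θstar)) ∧
    -- continuous covariates
    (∀ {d : ℕ} (𝒳 : Set (EuclideanSpace ℝ (Fin d))) (_h𝒳 : MeasurableSet 𝒳)
      (P : Measure (EuclideanSpace ℝ (Fin d) × 𝒴)) [IsProbabilityMeasure P]
      (_hP𝒳 : P.fst 𝒳ᶜ = 0) (_hac : P.fst ≪ volume)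
      (Z : ℕ → Ω → EuclideanSpace ℝ (Fin d) × 𝒴) (_hZ : IsIIDSample Z P μ)
      (K : EuclideanSpace ℝ (Fin d) → ℝ) (_hK : ∫ x, K x = 1)
      (h : ℕ → ℝ) (_hpos : ∀ n, 0 < h n) (_hh : Tendsto h atTop (𝓝 0))
      (_hnh : Tendsto (fun n : ℕ => (n : ℝ) * h n ^ d) atTop atTop)
      (f : EuclideanSpace ℝ (Fin q) → EuclideanSpace ℝ (Fin d) → 𝒴 → ℝ)
      (_hf : ∀ θ ∈ Θ, IsCondMass 𝒳 (f θ))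
      (θstar : EuclideanSpace ℝ (Fin q)) (ε : ℝ)
      (_hreg : RegularityAssumption μ Θ
        (fun θ => tvdCont 𝒳 (jointDensity P) (hybrid (f θ) (jointDensity P)))
        (fun n ω θ => tvdCont 𝒳 (kernelEstimate K (h n) Z n ω)
          (hybrid (f θ) (kernelEstimate K (h n) Z n ω)))
        θstar ε)
      (θhat : ℕ → Ω → EuclideanSpace ℝ (Fin q))
      (_hθ : ∀ᵐ ω ∂μ, ∀ᶠ n in atTop, IsUniqueMinimizer Θ
        (fun θ => tvdCont 𝒳 (kernelEstimate K (h n) Z n ω)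
          (hybrid (f θ) (kernelEstimate K (h n) Z n ω)))
        (θhat n ω)),
      ∀ᵐ ω ∂μ, Tendsto (fun n => θhat n ω)
        (comap (fun n => ⨅ y, outcomeCount Z n ω y) atTop) (𝓝 θstar)) := by
  refine ⟨?_, ?_⟩
  · intro 𝒳 _ _ _ P _ Z hZ f hf θstar ε hreg θhat hθ
    have hmass : ∀ᵐ ω ∂μ, ∀ x y,
        Tendsto (fun n => empiricalMass Z n ω x y) atTop (𝓝 (jointMass P x y)) :=
      ae_all_iff.2 fun x => ae_all_iff.2 fun y => hZ.tendsto_empiricalMass x y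
    filter_upwards [hmass, hθ] with ω hω hmin
    refine hreg.unique_min.tendsto_of_uniform hreg.eps_pos hreg.compact hreg.cont
      (D := fun n => 2 * tvdDiscrete (empiricalMass Z n ω) (jointMass P)) ?_
      (fun n θ hθΘ => abs_tvdDiscrete_hybrid_sub_le (hf θ hθΘ)) (hmin.mono fun n hn => ⟨hn.1, hn.2.1⟩)
    have h1 : Tendsto (fun n => tvdDiscrete (empiricalMass Z n ω) (jointMass P)) atTop
        (𝓝 (∑ _x : 𝒳, ∑ _y : 𝒴, 0)) := by
      refine tendsto_finsetSum _ fun x _ => tendsto_finsetSum _ fun y _ => ?_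
      simpa using ((hω x y).sub_const (jointMass P x y)).abs
    simpa using h1.const_mul 2
  · intro d 𝒳 h𝒳 P _ _ hac Z hZ K hK h hpos hh hnh f hf θstar ε hreg θhat hθ
    have hKi : Integrable K := Integrable.of_integral_ne_zero (by simp [hK])
    have hne : Nonempty 𝒴 := (nonempty_of_isProbabilityMeasure P).map Prod.snd
    have hdens : ∀ᵐ ω ∂μ, ∀ y, Tendsto
        (fun n => ∫ x, |kernelEstimate K (h n) Z n ω x y - jointDensity P x y|) atTop (𝓝 0) :=
      ae_all_iff.2 fun y => hZ.tendsto_integral_kernelEstimate hac hK hpos hh hnh y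
    filter_upwards [hdens, hθ] with ω hω hmin
    have hgi := fun n y => integrable_kernelEstimate hKi (hpos n) Z n ω y
    have hpi := fun y => integrable_jointDensity P y
    refine (hreg.unique_min.tendsto_of_uniform hreg.eps_pos hreg.compact hreg.cont
      (D := fun n => 2 * tvdCont 𝒳 (kernelEstimate K (h n) Z n ω) (jointDensity P)) ?_
      (fun n θ hθΘ => abs_tvdCont_hybrid_sub_le h𝒳 (hf θ hθΘ)
        (fun y => (hgi n y).integrableOn) (fun y => (hpi y).integrableOn))
      (hmin.mono fun n hn => ⟨hn.1, hn.2.1⟩)).mono_left (comap_iInf_outcomeCount_le Z ω)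
    have h1 : Tendsto (fun n => ∑ y, ∫ x, |kernelEstimate K (h n) Z n ω x y - jointDensity P x y|)
        atTop (𝓝 (∑ _y : 𝒴, 0)) := tendsto_finsetSum _ fun y _ => hω y
    rw [Finset.sum_const_zero] at h1
    have h2 : Tendsto (fun n => tvdCont 𝒳 (kernelEstimate K (h n) Z n ω) (jointDensity P)) atTop
        (𝓝 0) := squeeze_zero
      (fun n => integral_nonneg fun x => Finset.sum_nonneg fun y _ => abs_nonneg _)
      (fun n => tvdCont_le_sum_integral 𝒳 (hgi n) hpi) h1
    simpa using h2.const_mul 2
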